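/- Let $K\ge 2$ be an integer and let $X$ be the rooted $K$-ary tree with root $0$ (every vertex has exactly $K$ children), regarded as a metric graph in which every edge is an isometric copy of the unit interval. Let $|x|$ be the graph distance from $0$ to $x\in X$, let $[x,y]$ be the geodesic from $x$ to $y$, and let $d|z|$ be the measure on $X$ that is Lebesgue measure on each edge. Fix $\epsilon>0$, $\beta>\log K$, $\lambda>0$ with $(\beta-\log K)/\epsilon=1$ and a constant $C\ge\max\{2|\lambda|/(\beta-\log K),\,2(\log 4)/\epsilon\}$. Equip $X$ with the metric $d_X(x,y)=\int_{[x,y]}e^{-\epsilon|z|}\,d|z|$, whose arc length measure is $ds_X=e^{-\epsilon|z|}\,d|z|$, and with the measure $d\mu_\lambda=e^{-\beta|z|}(|z|+C)^\lambda\,d|z|$. The boundary $\partial X$ is the set of infinite geodesics $\xi=0x_1x_2\cdots$ starting at $0$, with the metric $d_X(\xi,\zeta)=\frac2\epsilon e^{-\epsilon k}$ for $\xi=0x_1x_2\cdots\neq\zeta=0y_1y_2\cdots$, where $k$ is the integer with $x_k=y_k$ and $x_{k+1}\ne y_{k+1}$ (here $x_0=y_0=0$). Let $\nu$ be a Borel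 measure on $\partial X$ that is Ahlfors $Q$-regular with $Q=\log K/\epsilon$: there is $A\ge1$ with $A^{-1}r^Q\le\nu(B(\xi,r))\le A r^Q$ for all $\xi\in\partial X$ and $0<r\le \operatorname{diam}\partial X=2/\epsilon$, where $B(\xi,r)$ is the open ball. A Borel function $g:X\to[0,\infty]$ is an upper gradient of $u:X\to\mathbb R$ if $|u(x)-u(y)|\le\int_{[x,y]}g\,ds_X$ for all $x,y\in X$. Let $N^{1,1}(X,\mu_\lambda)$ be the space of all $\mu_\lambda$-measurable $u:X\to\mathbb R$ with $$\|u\|_{N^{1,1}(X,\mu_\lambda)}=\int_X|u|\,d\mu_\lambda+\inf_g\int_X g\,d\mu_\lambda<\infty,$$ the infimum being over all upper gradients $g$ of $u$. Let $\alpha(n)$, $n=0,1,2,\dots$, be positive integers for which there are constants $c_1\ge c_0>1$ with $c_0\le\alpha(n+1)/\alpha(n)\le c_1$ for all $n\ge0$. For a vertex $x$ let $I_x\subset\partial X$ be the set of all $\xi$ whose geodesic $[0,\xi)$ passes through $x$, and let $\mathscr Q_m=\{I_x:|x|=m\}$. For $I=I_x\in\mathscr Q_{\alpha(n)}$, $n\ge1$,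 let $\widetilde I=I_y$, where $y$ is the ancestor of $x$ with $|y|=\alpha(n-1)$, and write $f_I=\nu(I)^{-1}\int_I f\,d\nu$. Let $\mathcal B^{0,\lambda}_\alpha(\partial X)$ be the space of all $f\in L^1(\partial X,\nu)$ with $$\|f\|_{\mathcal B^{0,\lambda}_\alpha(\partial X)}=\|f\|_{L^1(\partial X,\nu)}+\sum_{n=1}^\infty\alpha(n)^\lambda\sum_{I\in\mathscr Q_{\alpha(n)}}\nu(I)\,|f_I-f_{\widetilde I}|<\infty .$$ **Theorem.** $\mathcal B^{0,\lambda}_\alpha(\partial X)$ is the trace space of $N^{1,1}(X,\mu_\lambda)$. That is, there are linear operators $$T:N^{1,1}(X,\mu_\lambda)\to\mathcal B^{0,\lambda}_\alpha(\partial X),\qquad E:\mathcal B^{0,\lambda}_\alpha(\partial X)\to N^{1,1}(X,\mu_\lambda),$$ both bounded with respect to the norms above, such that $T\circ E=\mathrm{Id}$ on $\mathcal B^{0,\lambda}_\alpha(\partial X)$, where $T$ is the trace operator defined by limits along geodesic rays: for each $f\in N^{1,1}(X,\mu_\lambda)$, $Tf(\xi)=\lim_{[0,\xi)\ni x\to\xi}f(x)$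 for $\nu$-a.e. $\xi\in\partial X$ (in particular this limit exists for $\nu$-a.e. $\xi$). -/

import Mathlib

open MeasureTheory Filter Topology
open scoped ENNReal NNReal

/-- The boundary of the `K`-ary tree: infinite geodesics `ξ = 0 x₁ x₂ ⋯` from the root, coded by
infinite words, `x_n` being the vertex whose word consists of the letters `ξ 0, …, ξ (n - 1)`.
Its σ-algebra is the product one, i.e. the Borel σ-algebra of the visual metric. -/
abbrev TreeBoundary (K : ℕ) : Type := ℕ → Fin K

/-- The vertex of level `n` on the geodesic `[0, ξ)`. Vertices of the `K`-ary tree are the finite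
words over `Fin K`; the root is the empty word, and the level is the length of the word. -/
def TreeBoundary.vertex {K : ℕ} (ξ : TreeBoundary K) (n : ℕ) : List (Fin K) :=
  List.ofFn fun i : Fin n => ξ i

theorem TreeBoundary.length_vertex {K : ℕ} (ξ : TreeBoundary K) (n : ℕ) :
    (ξ.vertex n).length = n := by
  simp [TreeBoundary.vertex]

open Classical in
/-- The visual metric: `d(ξ, ζ) = (2/ε) e^{-εk}` if `x_k = y_k` and `x_{k+1} ≠ y_{k+1}`. -/
noncomputable def boundaryDist {K : ℕ} (ε : ℝ) (ξ ζ : TreeBoundary K) : ℝ :=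
  if ξ = ζ then 0 else 2 / ε * Real.exp (-ε * (PiNat.firstDiff ξ ζ : ℝ))

/-- Ahlfors `Q`-regularity of a Borel measure on the boundary, for the visual metric;
`2/ε` is the diameter of the boundary (for `K ≥ 2`). -/
def IsAhlforsRegular {K : ℕ} (ε Q : ℝ) (ν : Measure (TreeBoundary K)) : Prop :=
  ∃ A : ℝ, 1 ≤ A ∧ ∀ (ξ : TreeBoundary K) (r : ℝ), 0 < r → r ≤ 2 / ε →
    ENNReal.ofReal (A⁻¹ * r ^ Q) ≤ ν {ζ | boundaryDist ε ξ ζ < r} ∧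
    ν {ζ | boundaryDist ε ξ ζ < r} ≤ ENNReal.ofReal (A * r ^ Q)

/-- The dyadic set `I_x` of all boundary points whose geodesic from the root passes through the
vertex `x`. -/
def dyadicSet {K : ℕ} (x : List (Fin K)) : Set (TreeBoundary K) :=
  {ξ | ξ.vertex x.length = x}

/-- Points of the metric graph `X` of the `K`-ary tree, every edge being a copy of the unit
interval. A point is given by its distance `height` from the root (in the length of edges) and
by the first vertex `word` at or below it (away from the root), so `word` has level `⌈height⌉`.
Thus the root is `([], 0)`, and the edge from the parent of `y` to `y` consists, apart from the
parent, of the points `(y, h)` with `|y| - 1 < h ≤ |y|`. -/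
@[ext]
structure RegularTree (K : ℕ) where
  word : List (Fin K)
  height : ℝ
  height_nonneg : 0 ≤ height
  length_word : word.length = ⌈height⌉₊

namespace RegularTree

variable {K : ℕ}

/-- `x ≤ y` if the geodesic from the root to `y` passes through `x`. -/
instance : LE (RegularTree K) := ⟨fun x y => x.height ≤ y.height ∧ x.word <+: y.word⟩

/-- The geodesic `[x, y]`: it runs from `x` up to the last common ancestor of `x` and `y` and then
down to `y`. -/
def geodesic (x y : RegularTree K) : Set (RegularTree K) :=
  {z | (z ≤ x ∨ z ≤ y) ∧ ∀ w : RegularTree K, w ≤ x → w ≤ y → w ≤ z}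

/-- The point at distance `t` (for `t ≥ 0`) from the root on the geodesic ray `[0, ξ)`. -/
noncomputable def ray (ξ : TreeBoundary K) (t : ℝ) : RegularTree K where
  word := ξ.vertex ⌈max t 0⌉₊
  height := max t 0
  height_nonneg := le_max_right t 0
  length_word := ξ.length_vertex _

/-- A point of the tree as a pair consisting of a vertex (which selects an edge) and a height. -/
def toProd (x : RegularTree K) : List (Fin K) × ℝ := (x.word, x.height)

/-- The σ-algebra on pairs (edge, height), the countable set of edges being discrete. -/
abbrev prodMeasurableSpace (K : ℕ) : MeasurableSpace (List (Fin K) × ℝ) :=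
  @Prod.instMeasurableSpace _ _ ⊤ inferInstance

/-- The Borel σ-algebra of `X`. As `X` is the union of the root and of countably many half-open
edges, which are Borel sets, and as the metric of `X` induces on each edge the topology of an
interval, a set is Borel if and only if its trace on each edge is a Borel set of heights. -/
instance : MeasurableSpace (RegularTree K) := (prodMeasurableSpace K).comap toProd

/-- The measure `d|z|`, which is Lebesgue measure on every edge. -/
noncomputable def lengthMeasure (K : ℕ) : Measure (RegularTree K) :=
  @Measure.comap _ _ _ (prodMeasurableSpace K) toProd
    (@Measure.prod _ _ ⊤ _ (@Measure.count _ ⊤) volume)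

/-- The arc length measure `ds_X = e^{-ε|z|} d|z|` of the metric
`d_X(x, y) = ∫_{[x, y]} e^{-ε|z|} d|z|`. -/
noncomputable def arcLength (K : ℕ) (ε : ℝ) : Measure (RegularTree K) :=
  (lengthMeasure K).withDensity fun z => ENNReal.ofReal (Real.exp (-ε * z.height))

/-- The weighted measure `dμ_λ = e^{-β|z|} (|z| + C)^λ d|z|`. -/
noncomputable def weightedMeasure (K : ℕ) (β lam C : ℝ) : Measure (RegularTree K) :=
  (lengthMeasure K).withDensity fun z =>
    ENNReal.ofReal (Real.exp (-β * z.height) * (z.height + C) ^ lam)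

/-- `g : X → [0, ∞]` is an upper gradient of `u`. -/
def IsUpperGradient (ε : ℝ) (u : RegularTree K → ℝ) (g : RegularTree K → ℝ≥0∞) : Prop :=
  Measurable g ∧ ∀ x y : RegularTree K,
    ENNReal.ofReal |u x - u y| ≤ ∫⁻ z in geodesic x y, g z ∂(arcLength K ε)

/-- The norm of `N^{1,1}(X, μ)`, with value in `[0, ∞]`. -/
noncomputable def newtonNorm (ε : ℝ) (μ : Measure (RegularTree K)) (u : RegularTree K → ℝ) :
    ℝ≥0∞ :=
  ∫⁻ z, ENNReal.ofReal |u z| ∂μ +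
    ⨅ (g : RegularTree K → ℝ≥0∞) (_ : IsUpperGradient ε u g), ∫⁻ z, g z ∂μ

theorem newtonNorm_lt_top_iff {ε : ℝ} {μ : Measure (RegularTree K)} {u : RegularTree K → ℝ} :
    newtonNorm ε μ u < ∞ ↔ ∫⁻ z, ENNReal.ofReal |u z| ∂μ < ∞ ∧
      ∃ g, IsUpperGradient ε u g ∧ ∫⁻ z, g z ∂μ < ∞ := by
  simp [newtonNorm, ENNReal.add_lt_top, iInf_lt_iff]

/-- The Newtonian space `N^{1,1}(X, μ)`: functions in `L¹(X, μ)`, defined at every point of `X`,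
whose norm is finite. -/
def newtonSpace (ε : ℝ) (μ : Measure (RegularTree K)) : Submodule ℝ (RegularTree K → ℝ) where
  carrier := {u | AEStronglyMeasurable u μ ∧ newtonNorm ε μ u < ∞}
  zero_mem' := by
    refine ⟨aestronglyMeasurable_zero, newtonNorm_lt_top_iff.2 ⟨by simp, 0, ⟨measurable_zero, ?_⟩,
      by simp⟩⟩
    simp
  add_mem' := by
    rintro u v ⟨hu, hu'⟩ ⟨hv, hv'⟩
    obtain ⟨hu1, g, ⟨hg, hug⟩, hgi⟩ := newtonNorm_lt_top_iff.1 hu'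
    obtain ⟨hv1, k, ⟨hk, hvk⟩, hki⟩ := newtonNorm_lt_top_iff.1 hv'
    refine ⟨hu.add hv, newtonNorm_lt_top_iff.2 ⟨?_, g + k, ⟨hg.add hk, fun x y => ?_⟩, ?_⟩⟩
    · calc ∫⁻ z, ENNReal.ofReal |(u + v) z| ∂μ
          ≤ ∫⁻ z, (ENNReal.ofReal |u z| + ENNReal.ofReal |v z|) ∂μ := by
            refine lintegral_mono fun z => ?_
            rw [← ENNReal.ofReal_add (abs_nonneg _) (abs_nonneg _)]
            exact ENNReal.ofReal_le_ofReal (abs_add_le _ _)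
        _ = ∫⁻ z, ENNReal.ofReal |u z| ∂μ + ∫⁻ z, ENNReal.ofReal |v z| ∂μ := by
            refine lintegral_add_left' ?_ _
            exact (hu.norm.aemeasurable).ennreal_ofReal
        _ < ∞ := ENNReal.add_lt_top.2 ⟨hu1, hv1⟩
    · calc ENNReal.ofReal |(u + v) x - (u + v) y|
          ≤ ENNReal.ofReal (|u x - u y| + |v x - v y|) := by
            refine ENNReal.ofReal_le_ofReal ?_
            have : (u + v) x - (u + v) y = (u x - u y) + (v x - v y) := by
              simp only [Pi.add_apply]; ring
            rw [this]
            exact abs_add_le _ _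
        _ = ENNReal.ofReal |u x - u y| + ENNReal.ofReal |v x - v y| :=
            ENNReal.ofReal_add (abs_nonneg _) (abs_nonneg _)
        _ ≤ _ := add_le_add (hug x y) (hvk x y)
        _ = _ := (lintegral_add_left hg _).symm
    · simp only [Pi.add_apply]
      rw [lintegral_add_left hg]
      exact ENNReal.add_lt_top.2 ⟨hgi, hki⟩
  smul_mem' := by
    rintro c u ⟨hu, hu'⟩
    obtain ⟨hu1, g, ⟨hg, hug⟩, hgi⟩ := newtonNorm_lt_top_iff.1 hu'
    refine ⟨hu.const_smul c, newtonNorm_lt_top_iff.2 ⟨?_, fun z => ENNReal.ofReal |c| * g z,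
      ⟨hg.const_mul _, fun x y => ?_⟩, ?_⟩⟩
    · simp only [Pi.smul_apply, smul_eq_mul, abs_mul, ENNReal.ofReal_mul (abs_nonneg c)]
      rw [lintegral_const_mul' _ _ ENNReal.ofReal_ne_top]
      exact ENNReal.mul_lt_top ENNReal.ofReal_lt_top hu1
    · rw [lintegral_const_mul' _ _ ENNReal.ofReal_ne_top]
      simp only [Pi.smul_apply, smul_eq_mul, ← mul_sub, abs_mul,
        ENNReal.ofReal_mul (abs_nonneg c)]
      gcongr
      exact hug x y
    · rw [lintegral_const_mul' _ _ ENNReal.ofReal_ne_top]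
      exact ENNReal.mul_lt_top ENNReal.ofReal_lt_top hgi

end RegularTree

/-- The condition `c₀ ≤ α(n+1)/α(n) ≤ c₁` for all `n`, for some constants `c₁ ≥ c₀ > 1`. -/
def IsLacunary (α : ℕ → ℕ) : Prop :=
  ∃ c₀ c₁ : ℝ, 1 < c₀ ∧ c₀ ≤ c₁ ∧ ∀ n, 0 < α n ∧
    c₀ ≤ (α (n + 1) : ℝ) / (α n : ℝ) ∧ (α (n + 1) : ℝ) / (α n : ℝ) ≤ c₁

section Besov

variable {K : ℕ}

/-- The dyadic energy `∑_{n ≥ 1} α(n)^λ ∑_{I ∈ 𝒬_{α(n)}} ν(I) |f_I - f_Ĩ|`, where `𝒬_m` is the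
family of the sets `I_x` with `x` of level `m`, and `Ĩ = I_y` for `I = I_x`, with `y` the ancestor
of `x` of level `α(n-1)`. In the code `n` is shifted by one. -/
noncomputable def besovEnergy (lam : ℝ) (α : ℕ → ℕ) (ν : Measure (TreeBoundary K))
    (f : TreeBoundary K → ℝ) : ℝ≥0∞ :=
  ∑' n : ℕ, ENNReal.ofReal ((α (n + 1) : ℝ) ^ lam) *
    ∑ x : List.Vector (Fin K) (α (n + 1)),
      ν (dyadicSet x.toList) * ENNReal.ofReal
        |(⨍ ξ in dyadicSet x.toList, f ξ ∂ν) - ⨍ ξ in dyadicSet (x.toList.take (α n)), f ξ ∂ν|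

/-- The norm `‖f‖_{L¹(∂X)} +` dyadic energy, with value in `[0, ∞]`. -/
noncomputable def besovNorm (lam : ℝ) (α : ℕ → ℕ) (ν : Measure (TreeBoundary K))
    (f : TreeBoundary K → ℝ) : ℝ≥0∞ :=
  eLpNorm f 1 ν + besovEnergy lam α ν f

theorem besovEnergy_congr {lam : ℝ} {α : ℕ → ℕ} {ν : Measure (TreeBoundary K)}
    {f g : TreeBoundary K → ℝ} (h : f =ᵐ[ν] g) :
    besovEnergy lam α ν f = besovEnergy lam α ν g := by
  have key (s : Set (TreeBoundary K)) : (⨍ ξ in s, f ξ ∂ν) = ⨍ ξ in s, g ξ ∂ν :=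
    average_congr (ae_restrict_of_ae h)
  simp only [besovEnergy, key]

theorem besovEnergy_add_le {lam : ℝ} {α : ℕ → ℕ} {ν : Measure (TreeBoundary K)}
    {f g : TreeBoundary K → ℝ} (hf : Integrable f ν) (hg : Integrable g ν) :
    besovEnergy lam α ν (f + g) ≤ besovEnergy lam α ν f + besovEnergy lam α ν g := by
  have key (s : Set (TreeBoundary K)) :
      (⨍ ξ in s, (f + g) ξ ∂ν) = (⨍ ξ in s, f ξ ∂ν) + ⨍ ξ in s, g ξ ∂ν := by
    simp only [setAverage_eq, Pi.add_apply]
    rw [integral_add hf.integrableOn hg.integrableOn, smul_add]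
  rw [besovEnergy, besovEnergy, besovEnergy, ← ENNReal.tsum_add]
  refine ENNReal.tsum_le_tsum fun n => ?_
  rw [← mul_add, ← Finset.sum_add_distrib]
  gcongr with x
  rw [← mul_add, ← ENNReal.ofReal_add (abs_nonneg _) (abs_nonneg _), key, key]
  gcongr
  rw [add_sub_add_comm]
  exact abs_add_le _ _

theorem besovEnergy_smul {lam : ℝ} {α : ℕ → ℕ} {ν : Measure (TreeBoundary K)} (c : ℝ)
    (f : TreeBoundary K → ℝ) :
    besovEnergy lam α ν (c • f) = ENNReal.ofReal |c| * besovEnergy lam α ν f := by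
  have key (s : Set (TreeBoundary K)) : (⨍ ξ in s, (c • f) ξ ∂ν) = c * ⨍ ξ in s, f ξ ∂ν := by
    simp only [setAverage_eq, Pi.smul_apply, smul_eq_mul]
    rw [integral_const_mul]
    ring
  simp only [besovEnergy, key, ← mul_sub, abs_mul, ENNReal.ofReal_mul (abs_nonneg c)]
  rw [← ENNReal.tsum_mul_left]
  refine tsum_congr fun n => ?_
  rw [Finset.mul_sum, Finset.mul_sum, Finset.mul_sum]
  refine Finset.sum_congr rfl fun x _ => ?_
  ring

/-- The Besov-type space: all `f ∈ L¹(∂X)` whose dyadic energy is finite. -/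
noncomputable def besovSpace (lam : ℝ) (α : ℕ → ℕ) (ν : Measure (TreeBoundary K)) :
    Submodule ℝ (Lp ℝ 1 ν) where
  carrier := {f | besovEnergy lam α ν f < ∞}
  zero_mem' := by
    have h : besovEnergy lam α ν ((0 : Lp ℝ 1 ν) : TreeBoundary K → ℝ) =
        besovEnergy lam α ν (0 : TreeBoundary K → ℝ) :=
      besovEnergy_congr (Lp.coeFn_zero ℝ 1 ν)
    rw [Set.mem_ofPred_eq, h]
    simp [besovEnergy]
  add_mem' := by
    intro f g hf hg
    rw [Set.mem_ofPred_eq, besovEnergy_congr (Lp.coeFn_add f g)]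
    exact (besovEnergy_add_le (L1.integrable_coeFn f) (L1.integrable_coeFn g)).trans_lt
      (ENNReal.add_lt_top.2 ⟨hf, hg⟩)
  smul_mem' := by
    intro c f hf
    rw [Set.mem_ofPred_eq, besovEnergy_congr (Lp.coeFn_smul c f), besovEnergy_smul]
    exact ENNReal.mul_lt_top ENNReal.ofReal_lt_top hf

end Besov

/-!
The proof rests on one comparison. Since `β - log K = ε` and `ν(I_x)` is comparable to `K^{-|x|}`,
the integral of a function `g ≥ 0` against `μ_λ` is comparable to the integral over the boundary
of `∫ g e^{-εt} (t + C)^λ dt` along the rays `[0, ξ)`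
(`RegularTree.exists_lintegral_weightedMeasure_bounds`). An edge with lower end point `x` is run
through exactly by the rays of the points of `I_x`, so this is an identity of sums over edges
followed by a comparison of weights; all integrals over the tree are handled in this way.

*Trace.* If `g` is an integrable upper gradient of `u`, then `∫ g e^{-εt} dt` is finite along almost
every ray, so `u` converges along it, and the tail of this integral beyond height `s` controls the
distance of `u` at height `s` to the limit. Both averages in the `n`-th term of the energy are
compared with the value of `u` at the vertex of level `α(n)` (terms numbered as in `besovEnergy`), so that
the term is at most twice the tail beyond `α(n)`, integrated over the boundary
(`lintegral_abs_dyadicAverage_sub_le`). Summation over `n` yields the weight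
`∑_{α(n) ≤ t} α(n+1)^λ`, which geometric growth bounds by a multiple of `t^λ`
(`IsLacunary.exists_tsum_indicator_le`). This gives `RegularTree.exists_besovNorm_trace_le`.

*Extension.* The extension of `f` vanishes near the root, takes the value `f_{I_x}` at the vertices
`x` of the levels `α(n)`, and changes, linearly in the height, only on the edges that end at these
levels (`RegularTree.primitive` of `vertexIncrement`). Its slopes are thus the differences of
averages that make up the energy, together with the averages at level `α(0)`, which the `L¹` norm
controls (`exists_tsum_vertexIncrement_le`). The slopes provide an upper gradient
(`RegularTree.isUpperGradient_primitive`). The limit of the extension along a ray is computed on the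
levels `α(n)`, where Lévy's upward theorem identifies it with `f` (`ae_tendsto_dyadicAverage`).
-/

/-! ### Vertices and dyadic sets -/

/-- Words carry the discrete σ-algebra, the one underlying `RegularTree.prodMeasurableSpace`. -/
instance wordMeasurableSpace {K : ℕ} : MeasurableSpace (List (Fin K)) := ⊤

instance wordDiscreteMeasurableSpace {K : ℕ} : DiscreteMeasurableSpace (List (Fin K)) :=
  ⟨fun _ => trivial⟩

namespace TreeBoundary

variable {K : ℕ}

theorem vertex_getElem? (ξ : TreeBoundary K) (n i : ℕ) :
    (ξ.vertex n)[i]? = if i < n then some (ξ i) else none := by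
  simp [vertex, List.getElem?_ofFn]

theorem take_vertex (ξ : TreeBoundary K) {n m : ℕ} (h : n ≤ m) :
    (ξ.vertex m).take n = ξ.vertex n := by
  apply List.ext_getElem?
  intro i
  rw [List.getElem?_take, vertex_getElem?, vertex_getElem?]
  split_ifs <;> first | rfl | omega

theorem vertex_eq_iff {ξ ζ : TreeBoundary K} {n : ℕ} :
    ξ.vertex n = ζ.vertex n ↔ ∀ i < n, ξ i = ζ i := by
  rw [vertex, vertex, List.ofFn_inj, funext_iff]
  exact ⟨fun h i hi => h ⟨i, hi⟩, fun h i => h i i.2⟩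

theorem vertex_eq_mono {ξ ζ : TreeBoundary K} {n m : ℕ} (h : n ≤ m)
    (hm : ξ.vertex m = ζ.vertex m) : ξ.vertex n = ζ.vertex n :=
  vertex_eq_iff.2 fun i hi => vertex_eq_iff.1 hm i (hi.trans_le h)

theorem vertex_injective (ξ : TreeBoundary K) : Function.Injective ξ.vertex := fun n m h => by
  simpa [length_vertex] using congrArg List.length h

theorem exists_vertex_eq [NeZero K] (x : List (Fin K)) :
    ∃ ξ : TreeBoundary K, ξ.vertex x.length = x := by
  refine ⟨fun i => x.getD i 0, ?_⟩
  apply List.ext_getElem?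
  intro i
  rw [vertex_getElem?]
  split_ifs with h
  · simp [h]
  · rw [List.getElem?_eq_none (by omega)]

theorem measurable_vertex (n : ℕ) : Measurable fun ξ : TreeBoundary K => ξ.vertex n := by
  have h : Measurable fun (ξ : TreeBoundary K) (i : Fin n) => ξ i :=
    measurable_pi_lambda _ fun i => measurable_pi_apply _
  exact (Measurable.of_discrete (f := fun g : Fin n → Fin K => List.ofFn g)).comp h

theorem measurable_comp_vertex {γ : Type*} [MeasurableSpace γ] (n : ℕ) (G : List (Fin K) → γ) :
    Measurable fun ξ : TreeBoundary K => G (ξ.vertex n) :=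
  (Measurable.of_discrete (f := G)).comp (measurable_vertex n)

theorem measurableSet_dyadicSet (x : List (Fin K)) : MeasurableSet (dyadicSet x) :=
  measurable_vertex x.length (MeasurableSet.of_discrete (s := {x}))

theorem mem_dyadicSet_vertex {ξ ζ : TreeBoundary K} {n : ℕ} :
    ζ ∈ dyadicSet (ξ.vertex n) ↔ ζ.vertex n = ξ.vertex n := by
  simp [dyadicSet, length_vertex]

theorem dyadicSet_toList {n : ℕ} (x : List.Vector (Fin K) n) :
    dyadicSet x.toList = {ξ : TreeBoundary K | ξ.vertex n = x.toList} := by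
  simp [dyadicSet]

/-- The sets `I_x` with `x` of level `n` partition the boundary. -/
theorem lintegral_eq_sum_dyadicSet (ν : Measure (TreeBoundary K)) (n : ℕ)
    (F : TreeBoundary K → ℝ≥0∞) :
    ∫⁻ ξ, F ξ ∂ν = ∑ x : List.Vector (Fin K) n, ∫⁻ ξ in dyadicSet x.toList, F ξ ∂ν := by
  have hU : (⋃ x : List.Vector (Fin K) n, dyadicSet x.toList) =
      (Set.univ : Set (TreeBoundary K)) := by
    refine Set.eq_univ_of_forall fun ξ => Set.mem_iUnion.2 ⟨⟨ξ.vertex n, ξ.length_vertex n⟩, ?_⟩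
    simp [dyadicSet, List.Vector.toList, length_vertex]
  rw [← setLIntegral_univ, ← hU, lintegral_iUnion (fun x => measurableSet_dyadicSet _),
    tsum_fintype]
  intro x y hxy
  refine Set.disjoint_left.2 fun ξ hx hy => hxy ?_
  have hx' : ξ.vertex n = x.toList := (dyadicSet_toList x).subset hx
  have hy' : ξ.vertex n = y.toList := (dyadicSet_toList y).subset hy
  exact Subtype.ext (hx'.symm.trans hy')

theorem lintegral_comp_vertex (ν : Measure (TreeBoundary K)) (n : ℕ)
    (G : List (Fin K) → ℝ≥0∞) :
    ∫⁻ ξ, G (ξ.vertex n) ∂ν =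
      ∑ x : List.Vector (Fin K) n, ν (dyadicSet x.toList) * G x.toList := by
  rw [lintegral_eq_sum_dyadicSet ν n]
  refine Finset.sum_congr rfl fun x _ => ?_
  have : ∀ ξ ∈ dyadicSet x.toList, G (TreeBoundary.vertex ξ n) = G x.toList := by
    intro ξ hξ
    rw [dyadicSet_toList] at hξ
    exact congrArg G hξ
  rw [setLIntegral_congr_fun (measurableSet_dyadicSet _) this, setLIntegral_const, mul_comm]

/-- Only the vertices of the ray `[0, ξ)` contribute to a sum over all `x` with `ξ ∈ I_x`. -/
theorem tsum_indicator_dyadicSet (ξ : TreeBoundary K) (a : List (Fin K) → ℝ≥0∞) :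
    ∑' x, (dyadicSet x).indicator (fun _ => a x) ξ = ∑' n, a (ξ.vertex n) := by
  rw [← ξ.vertex_injective.tsum_eq]
  · refine tsum_congr fun n => ?_
    rw [Set.indicator_of_mem]
    simp [dyadicSet, length_vertex]
  · intro x hx
    refine ⟨x.length, ?_⟩
    by_contra h
    exact hx (Set.indicator_of_notMem (s := dyadicSet x) h _)

/-! ### The dyadic sets under Ahlfors regularity -/

theorem boundaryDist_lt_iff {ε : ℝ} (hε : 0 < ε) (ξ ζ : TreeBoundary K) (n : ℕ) :
    boundaryDist ε ξ ζ < 2 / ε * Real.exp (-ε * n) ↔ ζ.vertex (n + 1) = ξ.vertex (n + 1) := by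
  unfold boundaryDist
  split_ifs with h
  · subst h
    simp only [iff_true]
    positivity
  · rw [mul_lt_mul_iff_right₀ (by positivity), Real.exp_lt_exp, neg_mul, neg_mul, neg_lt_neg_iff,
      mul_lt_mul_iff_right₀ hε, Nat.cast_lt, vertex_eq_iff]
    constructor
    · intro hn i hi
      exact (PiNat.apply_eq_of_lt_firstDiff (by omega : i < PiNat.firstDiff ξ ζ)).symm
    · intro hn
      by_contra hlt
      exact PiNat.apply_firstDiff_ne h (hn _ (by omega)).symm

/-- The measure of `I_x` is comparable to `K^{-|x|} = e^{-|x| log K}`: the set `I_x` of a vertex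
`x` of level `n + 1` is an open ball of radius `(2/ε) e^{-εn}`. -/
theorem exists_measure_dyadicSet_bounds [NeZero K] {ε : ℝ} (hε : 0 < ε)
    {ν : Measure (TreeBoundary K)} (hν : IsAhlforsRegular ε (Real.log (K : ℝ) / ε) ν) :
    ∃ A : ℝ, 0 < A ∧ ∀ x : List (Fin K), x ≠ [] →
      ν (dyadicSet x) ≤ ENNReal.ofReal (A * Real.exp (-Real.log K * x.length)) ∧
      ENNReal.ofReal (Real.exp (-Real.log K * x.length)) ≤ ENNReal.ofReal A * ν (dyadicSet x) := by
  obtain ⟨A, hA, h⟩ := hν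
  have hK : 0 < (K : ℝ) := by exact_mod_cast Nat.pos_of_ne_zero (NeZero.ne K)
  set P : ℝ := (2 / ε) ^ (Real.log K / ε) with hP
  have hP0 : 0 < P := by positivity
  refine ⟨max (A * P * K) (A / P), by positivity, fun x hx => ?_⟩
  obtain ⟨ξ, hξ⟩ := exists_vertex_eq x
  obtain ⟨n, hn⟩ : ∃ n, x.length = n + 1 :=
    Nat.exists_eq_succ_of_ne_zero (by simpa using hx)
  have hr : 2 / ε * Real.exp (-ε * n) ≤ 2 / ε := by
    have : Real.exp (-ε * n) ≤ 1 := Real.exp_le_one_iff.2 (by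
      have : 0 ≤ ε * n := by positivity
      linarith)
    exact mul_le_of_le_one_right (by positivity) this
  have hb := h ξ (2 / ε * Real.exp (-ε * n)) (by positivity) hr
  have hset : {ζ | boundaryDist ε ξ ζ < 2 / ε * Real.exp (-ε * n)} = dyadicSet x := by
    ext ζ
    rw [Set.mem_ofPred_eq, boundaryDist_lt_iff hε, ← hn, hξ]
    rfl
  have hpow : (2 / ε * Real.exp (-ε * n)) ^ (Real.log K / ε) =
      P * K * Real.exp (-Real.log K * x.length) := by
    have hKe : (K : ℝ) * Real.exp (-Real.log K * x.length) = Real.exp (-Real.log K * n) := by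
      rw [hn, Nat.cast_add_one, mul_add_one, Real.exp_add, Real.exp_neg (Real.log K),
        Real.exp_log hK]
      field_simp
    rw [Real.mul_rpow (by positivity) (by positivity), ← Real.exp_mul, ← hP, mul_assoc P, hKe]
    congr 2
    field_simp
  rw [hset, hpow] at hb
  have hE : 0 < Real.exp (-Real.log K * x.length) := Real.exp_pos _
  constructor
  · refine hb.2.trans (ENNReal.ofReal_le_ofReal ?_)
    rw [← mul_assoc, ← mul_assoc]
    gcongr
    exact le_max_left _ _
  · calc ENNReal.ofReal (Real.exp (-Real.log K * x.length))
        ≤ ENNReal.ofReal (max (A * P * K) (A / P) *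
            (A⁻¹ * (P * K * Real.exp (-Real.log K * x.length)))) := by
          refine ENNReal.ofReal_le_ofReal ?_
          have hK1 : (1 : ℝ) ≤ K := by exact_mod_cast Nat.pos_of_ne_zero (NeZero.ne K)
          calc Real.exp (-Real.log K * x.length)
              ≤ K * Real.exp (-Real.log K * x.length) := le_mul_of_one_le_left hE.le hK1
            _ = A / P * (A⁻¹ * (P * K * Real.exp (-Real.log K * x.length))) := by
              field_simp
            _ ≤ _ := by gcongr; exact le_max_right _ _
      _ ≤ _ := by
          rw [ENNReal.ofReal_mul (by positivity)]
          gcongr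
          exact hb.1

end TreeBoundary

/-! ### Integration over the tree -/

/-- The heights of the points of an edge whose lower end point has level `n`: the interval
`(n - 1, n]`, or `{0}` if `n = 0`. -/
def edgeHeights (n : ℕ) : Set ℝ := {t | 0 ≤ t ∧ ⌈t⌉₊ = n}

theorem measurableSet_edgeHeights (n : ℕ) : MeasurableSet (edgeHeights n) :=
  measurableSet_Ici.inter (Nat.measurable_ceil (MeasurableSet.singleton n))

theorem edgeHeights_zero : edgeHeights 0 = {0} := by
  ext t
  simp only [edgeHeights, Nat.ceil_eq_zero, Set.mem_ofPred_eq, Set.mem_singleton_iff]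
  exact ⟨fun h => le_antisymm h.2 h.1, fun h => by simp [h]⟩

theorem edgeHeights_succ (n : ℕ) : edgeHeights (n + 1) = Set.Ioc (n : ℝ) (n + 1) := by
  ext t
  simp only [edgeHeights, Set.mem_ofPred_eq, Set.mem_Ioc, Nat.ceil_eq_iff n.succ_ne_zero]
  push_cast
  constructor
  · rintro ⟨-, h⟩
    simpa using h
  · intro h
    have : (0 : ℝ) ≤ n := n.cast_nonneg
    exact ⟨by linarith [h.1], by simpa using h⟩

theorem volume_edgeHeights_le (n : ℕ) : volume (edgeHeights n) ≤ 1 := by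
  cases n with
  | zero => simp [edgeHeights_zero]
  | succ n => simp [edgeHeights_succ]

theorem lintegral_Ici_eq_tsum (h : ℝ → ℝ≥0∞) :
    ∫⁻ t in Set.Ici 0, h t = ∑' n, ∫⁻ t in edgeHeights n, h t := by
  have hU : Set.Ici (0 : ℝ) = ⋃ n, edgeHeights n := by
    ext t
    simp [edgeHeights]
  rw [hU, lintegral_iUnion measurableSet_edgeHeights]
  intro n m hnm
  exact Set.disjoint_left.2 fun t h₁ h₂ => hnm (h₁.2.symm.trans h₂.2)

namespace RegularTree

variable {K : ℕ}

open Classical in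
/-- The point of height `t` on the edge with lower end point `x`; the root if there is no such
point. -/
noncomputable def edgePoint (x : List (Fin K)) (t : ℝ) : RegularTree K :=
  if h : t ∈ edgeHeights x.length then ⟨x, t, h.1, h.2.symm⟩ else ⟨[], 0, le_rfl, by simp⟩

theorem edgePoint_word {x : List (Fin K)} {t : ℝ} (h : t ∈ edgeHeights x.length) :
    (edgePoint x t).word = x := by
  rw [edgePoint, dif_pos h]

theorem edgePoint_height {x : List (Fin K)} {t : ℝ} (h : t ∈ edgeHeights x.length) :
    (edgePoint x t).height = t := by
  rw [edgePoint, dif_pos h]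

theorem height_mem_edgeHeights (z : RegularTree K) : z.height ∈ edgeHeights z.word.length :=
  ⟨z.height_nonneg, z.length_word.symm⟩

theorem edgePoint_word_height (z : RegularTree K) : edgePoint z.word z.height = z := by
  rw [edgePoint, dif_pos z.height_mem_edgeHeights]

theorem ray_word (ξ : TreeBoundary K) {t : ℝ} (ht : 0 ≤ t) : (ray ξ t).word = ξ.vertex ⌈t⌉₊ := by
  simp [ray, max_eq_left ht]

theorem ray_height (ξ : TreeBoundary K) {t : ℝ} (ht : 0 ≤ t) : (ray ξ t).height = t := by
  simp [ray, max_eq_left ht]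

theorem ray_eq_iff {ξ : TreeBoundary K} {t : ℝ} (ht : 0 ≤ t) {z : RegularTree K} :
    z = ray ξ t ↔ z.height = t ∧ z.word = ξ.vertex ⌈t⌉₊ := by
  rw [RegularTree.ext_iff, ray_word ξ ht, ray_height ξ ht, and_comm]

theorem edgePoint_vertex (ξ : TreeBoundary K) {n : ℕ} {t : ℝ} (ht : t ∈ edgeHeights n) :
    edgePoint (ξ.vertex n) t = ray ξ t := by
  have ht' : t ∈ edgeHeights (ξ.vertex n).length := by rwa [ξ.length_vertex]
  rw [ray_eq_iff ht.1, edgePoint_word ht', edgePoint_height ht', ht.2]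
  exact ⟨rfl, rfl⟩

theorem exists_ray_eq [NeZero K] (z : RegularTree K) : ∃ ξ, z = ray ξ z.height := by
  obtain ⟨ξ, hξ⟩ := TreeBoundary.exists_vertex_eq z.word
  exact ⟨ξ, (ray_eq_iff z.height_nonneg).2 ⟨rfl, by rw [← z.length_word, hξ]⟩⟩

theorem toProd_injective : Function.Injective (toProd (K := K)) := fun x y h => by
  simp only [toProd, Prod.mk.injEq] at h
  exact RegularTree.ext h.1 h.2

theorem measurable_toProd : Measurable (toProd (K := K)) := comap_measurable _

theorem measurable_height : Measurable (height (K := K)) := measurable_snd.comp measurable_toProd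

theorem measurable_word : Measurable (word (K := K)) := measurable_fst.comp measurable_toProd

theorem measurable_of_edges {γ : Type*} [MeasurableSpace γ] {F : List (Fin K) → ℝ → γ}
    (hF : ∀ x, Measurable (F x)) : Measurable fun z : RegularTree K => F z.word z.height :=
  (measurable_from_prod_countable_right (f := fun p : List (Fin K) × ℝ => F p.1 p.2) hF).comp
    measurable_toProd

theorem range_toProd :
    Set.range (toProd (K := K)) = {p | p.2 ∈ edgeHeights p.1.length} := by
  ext ⟨x, t⟩
  constructor
  · rintro ⟨z, hz⟩
    simp only [toProd, Prod.mk.injEq] at hz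
    rw [Set.mem_ofPred_eq, ← hz.1, ← hz.2]
    exact z.height_mem_edgeHeights
  · intro h
    exact ⟨edgePoint x t, Prod.ext (edgePoint_word h) (edgePoint_height h)⟩

theorem measurableSet_range_toProd : MeasurableSet (Set.range (toProd (K := K))) := by
  rw [range_toProd]
  have h : Measurable fun p : List (Fin K) × ℝ =>
      (edgeHeights p.1.length).indicator (fun _ => (1 : ℝ)) p.2 :=
    measurable_from_prod_countable_right fun x =>
      measurable_const.indicator (measurableSet_edgeHeights x.length)
  have h2 : {p : List (Fin K) × ℝ | p.2 ∈ edgeHeights p.1.length} =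
      (fun p : List (Fin K) × ℝ =>
        (edgeHeights p.1.length).indicator (fun _ => (1 : ℝ)) p.2) ⁻¹' {1} := by
    ext p
    by_cases hp : p.2 ∈ edgeHeights p.1.length <;> simp [hp]
  rw [h2]
  exact h (MeasurableSet.singleton 1)

theorem measurableEmbedding_toProd : MeasurableEmbedding (toProd (K := K)) where
  injective := toProd_injective
  measurable := measurable_toProd
  measurableSet_image' := by
    rintro _ ⟨B, hB, rfl⟩
    rw [Set.image_preimage_eq_inter_range]
    exact hB.inter measurableSet_range_toProd

open Classical in
theorem measurable_edgePoint (x : List (Fin K)) : Measurable (edgePoint x) := by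
  rw [measurable_comap_iff]
  have : toProd ∘ edgePoint x = fun t => (edgeHeights x.length).piecewise (fun t => (x, t))
      (fun _ => ([], 0)) t := by
    funext t
    by_cases h : t ∈ edgeHeights x.length <;> simp [h, edgePoint, toProd]
  rw [this]
  exact Measurable.piecewise (measurableSet_edgeHeights _) measurable_prodMk_left measurable_const

/-- The integral against `d|z|` is the sum over all edges of integrals over intervals. -/
theorem lintegral_lengthMeasure {F : RegularTree K → ℝ≥0∞} (hF : Measurable F) :
    ∫⁻ z, F z ∂(lengthMeasure K) =
      ∑' x : List (Fin K), ∫⁻ t in edgeHeights x.length, F (edgePoint x t) := by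
  set F' : List (Fin K) × ℝ → ℝ≥0∞ := fun p => F (edgePoint p.1 p.2) with hF'
  have hF'm : Measurable F' :=
    measurable_from_prod_countable_right fun x => hF.comp (measurable_edgePoint x)
  have h1 : ∫⁻ z, F z ∂(lengthMeasure K) =
      ∫⁻ z, F' (toProd z) ∂(Measure.comap toProd (Measure.count.prod volume)) := by
    refine lintegral_congr fun z => ?_
    rw [hF']
    exact congrArg F (edgePoint_word_height z).symm
  rw [h1, ← measurableEmbedding_toProd.lintegral_map F', measurableEmbedding_toProd.map_comap,
    ← lintegral_indicator measurableSet_range_toProd,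
    lintegral_prod _ (hF'm.indicator measurableSet_range_toProd).aemeasurable, lintegral_count]
  refine tsum_congr fun x => ?_
  rw [← lintegral_indicator (measurableSet_edgeHeights _)]
  refine lintegral_congr fun t => ?_
  by_cases h : t ∈ edgeHeights x.length
  · rw [Set.indicator_of_mem h, Set.indicator_of_mem]
    rw [range_toProd]
    exact h
  · rw [Set.indicator_of_notMem h, Set.indicator_of_notMem]
    rw [range_toProd]
    exact h

/-- The points of the ray `[0, ξ)` whose height lies in `S`. -/
def raySegment (ξ : TreeBoundary K) (S : Set ℝ) : Set (RegularTree K) :=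
  {z | z.height ∈ S ∧ z = ray ξ z.height}

theorem mem_raySegment {ξ : TreeBoundary K} {S : Set ℝ} {z : RegularTree K} :
    z ∈ raySegment ξ S ↔ z.height ∈ S ∧ ξ ∈ dyadicSet z.word := by
  rw [raySegment, Set.mem_ofPred_eq, ray_eq_iff z.height_nonneg, ← z.length_word]
  simp [dyadicSet, eq_comm]

theorem measurableSet_raySegment (ξ : TreeBoundary K) {S : Set ℝ} (hS : MeasurableSet S) :
    MeasurableSet (raySegment ξ S) := by
  have : raySegment ξ S = height ⁻¹' S ∩ word ⁻¹' {x | ξ ∈ dyadicSet x} := by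
    ext z
    exact mem_raySegment
  rw [this]
  exact (measurable_height hS).inter (measurable_word MeasurableSet.of_discrete)

theorem setLIntegral_raySegment (ξ : TreeBoundary K) {S : Set ℝ} (hS : MeasurableSet S)
    (hS0 : S ⊆ Set.Ici 0) {F : RegularTree K → ℝ≥0∞} (hF : Measurable F) :
    ∫⁻ z in raySegment ξ S, F z ∂(lengthMeasure K) = ∫⁻ t in S, F (ray ξ t) := by
  have hm := measurableSet_raySegment ξ hS
  rw [← lintegral_indicator hm, lintegral_lengthMeasure (hF.indicator hm)]
  have h1 : ∀ x : List (Fin K), ∫⁻ t in edgeHeights x.length,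
      (raySegment ξ S).indicator F (edgePoint x t) = (dyadicSet x).indicator (fun _ =>
        ∫⁻ t in edgeHeights x.length, S.indicator (fun t => F (edgePoint x t)) t) ξ := by
    intro x
    by_cases hx : ξ ∈ dyadicSet x
    · rw [Set.indicator_of_mem hx]
      refine setLIntegral_congr_fun (measurableSet_edgeHeights _) fun t ht => ?_
      by_cases htS : t ∈ S
      · rw [Set.indicator_of_mem, Set.indicator_of_mem htS]
        rw [mem_raySegment, edgePoint_word ht, edgePoint_height ht]
        exact ⟨htS, hx⟩
      · rw [Set.indicator_of_notMem, Set.indicator_of_notMem htS]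
        rw [mem_raySegment, edgePoint_height ht]
        exact fun h => htS h.1
    · rw [Set.indicator_of_notMem hx]
      refine (setLIntegral_congr_fun (measurableSet_edgeHeights _) (g := 0) fun t ht => ?_).trans
        (by simp)
      rw [Set.indicator_of_notMem]
      · rfl
      · rw [mem_raySegment, edgePoint_word ht]
        exact fun h => hx h.2
  rw [tsum_congr h1, TreeBoundary.tsum_indicator_dyadicSet ξ fun x =>
    ∫⁻ t in edgeHeights x.length, S.indicator (fun t => F (edgePoint x t)) t]
  have h2 : ∀ n, ∫⁻ t in edgeHeights (ξ.vertex n).length,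
      S.indicator (fun t => F (edgePoint (ξ.vertex n) t)) t =
      ∫⁻ t in edgeHeights n, S.indicator (fun t => F (ray ξ t)) t := by
    intro n
    rw [ξ.length_vertex]
    refine setLIntegral_congr_fun (measurableSet_edgeHeights _) fun t ht => ?_
    simp only [Set.indicator, edgePoint_vertex ξ ht]
  rw [tsum_congr h2, ← lintegral_Ici_eq_tsum, lintegral_indicator hS, Measure.restrict_restrict hS,
    Set.inter_eq_left.2 hS0]

theorem measurable_ray (ξ : TreeBoundary K) : Measurable (ray ξ) := by
  rw [measurable_comap_iff]
  have h : Measurable fun t : ℝ => max t 0 := measurable_id.max measurable_const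
  have h1 : Measurable fun t : ℝ => ξ.vertex ⌈max t 0⌉₊ :=
    (Measurable.of_discrete (f := ξ.vertex)).comp (Nat.measurable_ceil.comp h)
  exact h1.prodMk h

theorem lintegral_ray_eq_tsum (ξ : TreeBoundary K) (h : RegularTree K → ℝ≥0∞) :
    ∫⁻ t in Set.Ici 0, h (ray ξ t) =
      ∑' n, ∫⁻ t in edgeHeights n, h (edgePoint (ξ.vertex n) t) := by
  rw [lintegral_Ici_eq_tsum]
  refine tsum_congr fun n => setLIntegral_congr_fun (measurableSet_edgeHeights _) fun t ht => ?_
  simp only [edgePoint_vertex ξ ht]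

theorem measurable_lintegral_ray (h : RegularTree K → ℝ≥0∞) :
    Measurable fun ξ : TreeBoundary K => ∫⁻ t in Set.Ici 0, h (ray ξ t) := by
  simp only [lintegral_ray_eq_tsum]
  exact Measurable.tsum fun n => TreeBoundary.measurable_comp_vertex n
    fun x => ∫⁻ t in edgeHeights n, h (edgePoint x t)

/-- Fubini's theorem for the family of all rays: an edge with lower end point `x` is run through by
the rays `[0, ξ)` with `ξ ∈ I_x`. -/
theorem lintegral_lintegral_ray (ν : Measure (TreeBoundary K)) (h : RegularTree K → ℝ≥0∞) :
    ∫⁻ ξ, (∫⁻ t in Set.Ici 0, h (ray ξ t)) ∂ν =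
      ∑' x : List (Fin K),
        ν (dyadicSet x) * ∫⁻ t in edgeHeights x.length, h (edgePoint x t) := by
  have h1 : ∀ ξ : TreeBoundary K, ∫⁻ t in Set.Ici 0, h (ray ξ t) =
      ∑' x, (dyadicSet x).indicator
        (fun _ => ∫⁻ t in edgeHeights x.length, h (edgePoint x t)) ξ := by
    intro ξ
    rw [lintegral_ray_eq_tsum, TreeBoundary.tsum_indicator_dyadicSet ξ fun x =>
      ∫⁻ t in edgeHeights x.length, h (edgePoint x t)]
    simp only [ξ.length_vertex]
  simp only [h1]
  rw [lintegral_tsum fun x =>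
    (measurable_const.indicator (TreeBoundary.measurableSet_dyadicSet x)).aemeasurable]
  refine tsum_congr fun x => ?_
  rw [lintegral_indicator_const (TreeBoundary.measurableSet_dyadicSet x), mul_comm]

/-! ### Comparison of the weighted measure with integrals along rays -/

/-- The weight `e^{-εt} (t + C)^λ` that `μ_λ` induces along rays: the number `K^n` of edges at level
`n` turns the factor `e^{-βt}` into `e^{-εt}`, as `β - log K = ε`. -/
noncomputable def rayWeight (ε lam C t : ℝ) : ℝ≥0∞ :=
  ENNReal.ofReal (Real.exp (-ε * t) * (t + C) ^ lam)

theorem measurable_rayWeight (ε lam C : ℝ) : Measurable (rayWeight ε lam C) := by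
  unfold rayWeight
  fun_prop

/-- The integral of `g` against `μ_λ` is comparable to the integral over the boundary of the
integrals of `g` along the rays with weight `e^{-εt} (t + C)^λ`. -/
theorem exists_lintegral_weightedMeasure_bounds [NeZero K] {β ε lam C : ℝ} (hε : 0 < ε)
    (hβ : β - Real.log K = ε) {ν : Measure (TreeBoundary K)}
    (hν : IsAhlforsRegular ε (Real.log (K : ℝ) / ε) ν) :
    ∃ A : ℝ≥0, ∀ g : RegularTree K → ℝ≥0∞, Measurable g →
      ∫⁻ ξ, (∫⁻ t in Set.Ici 0, g (ray ξ t) * rayWeight ε lam C t) ∂ν ≤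
        A * ∫⁻ z, g z ∂(weightedMeasure K β lam C) ∧
      ∫⁻ z, g z ∂(weightedMeasure K β lam C) ≤
        A * ∫⁻ ξ, (∫⁻ t in Set.Ici 0, g (ray ξ t) * rayWeight ε lam C t) ∂ν := by
  obtain ⟨A, hA, hAν⟩ := TreeBoundary.exists_measure_dyadicSet_bounds hε hν
  have hK : (1 : ℝ) ≤ K := by exact_mod_cast Nat.pos_of_ne_zero (NeZero.ne K)
  have hlK : 0 ≤ Real.log K := Real.log_nonneg hK
  refine ⟨Real.toNNReal (A * K), fun g hg => ?_⟩
  have hA' : ((Real.toNNReal (A * K) : ℝ≥0) : ℝ≥0∞) = ENNReal.ofReal (A * K) := rfl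
  set w : RegularTree K → ℝ≥0∞ := fun z =>
    ENNReal.ofReal (Real.exp (-β * z.height) * (z.height + C) ^ lam) with hw
  have hwm : Measurable w := by
    have : Measurable fun t : ℝ => ENNReal.ofReal (Real.exp (-β * t) * (t + C) ^ lam) := by
      fun_prop
    exact this.comp measurable_height
  have hint : ∫⁻ z, g z ∂(weightedMeasure K β lam C) =
      ∑' x : List (Fin K), ∫⁻ t in edgeHeights x.length,
        ENNReal.ofReal (Real.exp (-Real.log K * t)) *
          (g (edgePoint x t) * rayWeight ε lam C t) := by
    rw [weightedMeasure, lintegral_withDensity_eq_lintegral_mul _ hwm hg,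
      lintegral_lengthMeasure (hwm.mul hg)]
    refine tsum_congr fun x =>
      setLIntegral_congr_fun (measurableSet_edgeHeights _) fun t ht => ?_
    simp only [Pi.mul_apply, hw, edgePoint_height ht, rayWeight]
    rw [mul_left_comm, ← ENNReal.ofReal_mul (Real.exp_pos _).le, mul_comm, ← mul_assoc,
      ← Real.exp_add]
    congr 5
    rw [← hβ]
    ring
  have hfub : ∫⁻ ξ, (∫⁻ t in Set.Ici 0, g (ray ξ t) * rayWeight ε lam C t) ∂ν =
      ∑' x : List (Fin K), ν (dyadicSet x) * ∫⁻ t in edgeHeights x.length,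
        g (edgePoint x t) * rayWeight ε lam C t := by
    have := lintegral_lintegral_ray ν fun z => g z * rayWeight ε lam C z.height
    rw [show ∫⁻ ξ, (∫⁻ t in Set.Ici 0, g (ray ξ t) * rayWeight ε lam C t) ∂ν =
      ∫⁻ ξ, (∫⁻ t in Set.Ici 0,
        g (ray ξ t) * rayWeight ε lam C (ray ξ t).height) ∂ν from
        lintegral_congr fun ξ => setLIntegral_congr_fun measurableSet_Ici fun t ht => by
          simp only [ray_height ξ ht],
      this]
    refine tsum_congr fun x => congrArg _ <|
      setLIntegral_congr_fun (measurableSet_edgeHeights _) fun t ht => ?_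
    simp only [edgePoint_height ht]
  have hmeas : ∀ x : List (Fin K), Measurable fun t =>
      g (edgePoint x t) * rayWeight ε lam C t := fun x =>
    (hg.comp (measurable_edgePoint x)).mul (measurable_rayWeight ε lam C)
  rw [hint, hfub, hA', ← ENNReal.tsum_mul_left, ← ENNReal.tsum_mul_left]
  constructor
  · refine ENNReal.tsum_le_tsum fun x => ?_
    by_cases hx : x = []
    · subst hx
      simp [edgeHeights_zero]
    rw [← lintegral_const_mul _ (hmeas x), ← lintegral_const_mul']
    swap; · exact ENNReal.ofReal_ne_top
    refine setLIntegral_mono' (measurableSet_edgeHeights _) fun t ht => ?_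
    rw [← mul_assoc (ENNReal.ofReal (A * K))]
    gcongr
    refine (hAν x hx).1.trans ?_
    rw [← ENNReal.ofReal_mul (by positivity)]
    refine ENNReal.ofReal_le_ofReal ?_
    have htx : t ≤ x.length := by
      rw [← ht.2]
      exact Nat.le_ceil t
    have h1 : A ≤ A * K := le_mul_of_one_le_right hA.le hK
    refine mul_le_mul h1 (Real.exp_le_exp.2 ?_) (Real.exp_pos _).le (by positivity)
    rw [neg_mul, neg_mul, neg_le_neg_iff]
    gcongr
  · refine ENNReal.tsum_le_tsum fun x => ?_
    by_cases hx : x = []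
    · subst hx
      simp [edgeHeights_zero]
    rw [← lintegral_const_mul _ (hmeas x), ← lintegral_const_mul']
    swap; · exact ENNReal.ofReal_ne_top
    refine setLIntegral_mono' (measurableSet_edgeHeights _) fun t ht => ?_
    rw [← mul_assoc (ENNReal.ofReal (A * K))]
    gcongr
    have htx : (x.length : ℝ) - 1 ≤ t := by
      have := Nat.ceil_lt_add_one ht.1
      rw [ht.2] at this
      linarith
    have hKe : (K : ℝ) * Real.exp (-Real.log K * x.length) =
        Real.exp (-Real.log K * (x.length - 1)) := by
      rw [mul_sub_one, sub_eq_add_neg, Real.exp_add, neg_neg, Real.exp_log (by linarith), mul_comm]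
    calc ENNReal.ofReal (Real.exp (-Real.log K * t))
        ≤ ENNReal.ofReal (K * Real.exp (-Real.log K * x.length)) := by
          refine ENNReal.ofReal_le_ofReal ?_
          rw [hKe, Real.exp_le_exp, neg_mul, neg_mul, neg_le_neg_iff]
          gcongr
      _ = ENNReal.ofReal K * ENNReal.ofReal (Real.exp (-Real.log K * x.length)) :=
          ENNReal.ofReal_mul (by positivity)
      _ ≤ ENNReal.ofReal K * (ENNReal.ofReal A * ν (dyadicSet x)) := by
          gcongr
          exact (hAν x hx).2
      _ = ENNReal.ofReal (A * K) * ν (dyadicSet x) := by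
          rw [ENNReal.ofReal_mul hA.le]
          ring

end RegularTree

/-! ### Upper gradients along rays and existence of the trace -/

namespace RegularTree

variable {K : ℕ}

theorem le_def {x y : RegularTree K} : x ≤ y ↔ x.height ≤ y.height ∧ x.word <+: y.word := Iff.rfl

theorem le_ray_iff {ξ : TreeBoundary K} {t : ℝ} (ht : 0 ≤ t) {z : RegularTree K} :
    z ≤ ray ξ t ↔ z.height ≤ t ∧ z = ray ξ z.height := by
  rw [le_def, ray_height ξ ht, ray_word ξ ht, ray_eq_iff z.height_nonneg]
  refine and_congr_right fun h => ?_
  have hle : ⌈z.height⌉₊ ≤ ⌈t⌉₊ := Nat.ceil_mono h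
  rw [List.prefix_iff_eq_take, z.length_word, ξ.take_vertex hle]
  simp

theorem measurable_arcDensity (ε : ℝ) :
    Measurable fun z : RegularTree K => ENNReal.ofReal (Real.exp (-ε * z.height)) := by
  have : Measurable fun t : ℝ => ENNReal.ofReal (Real.exp (-ε * t)) := by fun_prop
  exact this.comp measurable_height

theorem setLIntegral_arcLength_raySegment (ε : ℝ) (ξ : TreeBoundary K) {S : Set ℝ}
    (hS : MeasurableSet S) (hS0 : S ⊆ Set.Ici 0) {g : RegularTree K → ℝ≥0∞} (hg : Measurable g) :
    ∫⁻ z in raySegment ξ S, g z ∂(arcLength K ε) =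
      ∫⁻ t in S, g (ray ξ t) * ENNReal.ofReal (Real.exp (-ε * t)) := by
  rw [arcLength, setLIntegral_withDensity_eq_setLIntegral_mul _ (measurable_arcDensity ε) hg
    (measurableSet_raySegment ξ hS), setLIntegral_raySegment ξ hS hS0
      ((measurable_arcDensity ε).mul hg)]
  refine setLIntegral_congr_fun hS fun t ht => ?_
  simp only [Pi.mul_apply, ray_height ξ (hS0 ht), mul_comm]

theorem geodesic_ray_subset (ξ : TreeBoundary K) {s t : ℝ} (hs : 0 ≤ s) (hst : s ≤ t) :
    geodesic (ray ξ s) (ray ξ t) ⊆ raySegment ξ (Set.Icc s t) := by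
  have ht := hs.trans hst
  rintro z ⟨hz, hw⟩
  have hz' : z.height ≤ t ∧ z = ray ξ z.height := by
    rcases hz with hz | hz
    · rw [le_ray_iff hs] at hz
      exact ⟨hz.1.trans hst, hz.2⟩
    · rwa [le_ray_iff ht] at hz
  have h1 : (ray ξ s).height = s := ray_height ξ hs
  have hsz := hw (ray ξ s) ((le_ray_iff hs).2 ⟨h1.le, by rw [h1]⟩)
    ((le_ray_iff ht).2 ⟨h1.trans_le hst, by rw [h1]⟩)
  exact ⟨⟨h1.symm.trans_le hsz.1, hz'.1⟩, hz'.2⟩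

theorem IsUpperGradient.ofReal_abs_sub_ray_le {ε : ℝ} {u : RegularTree K → ℝ}
    {g : RegularTree K → ℝ≥0∞} (h : IsUpperGradient ε u g) (ξ : TreeBoundary K) {s t : ℝ}
    (hs : 0 ≤ s) (hst : s ≤ t) :
    ENNReal.ofReal |u (ray ξ s) - u (ray ξ t)| ≤
      ∫⁻ τ in Set.Icc s t, g (ray ξ τ) * ENNReal.ofReal (Real.exp (-ε * τ)) := by
  refine (h.2 _ _).trans ((lintegral_mono_set (geodesic_ray_subset ξ hs hst)).trans_eq ?_)
  exact setLIntegral_arcLength_raySegment ε ξ measurableSet_Icc (fun τ hτ => hs.trans hτ.1) h.1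

end RegularTree

theorem tendsto_setLIntegral_Ici_zero {h : ℝ → ℝ≥0∞} (hfin : ∫⁻ t in Set.Ici 0, h t ≠ ∞) :
    Tendsto (fun s : ℝ => ∫⁻ t in Set.Ici s, h t) atTop (𝓝 0) := by
  have h1 : ∀ s : ℝ, volume.withDensity h (Set.Ici s) = ∫⁻ t in Set.Ici s, h t := fun s =>
    withDensity_apply _ measurableSet_Ici
  have h2 := tendsto_measure_iInter_atTop (μ := volume.withDensity h) (s := fun s : ℝ => Set.Ici s)
    (fun s => measurableSet_Ici.nullMeasurableSet) (fun a b hab => Set.Ici_subset_Ici.2 hab)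
    ⟨0, by rwa [h1]⟩
  have h3 : ⋂ s : ℝ, Set.Ici s = ∅ := by
    refine Set.eq_empty_of_forall_notMem fun t ht => ?_
    have := Set.mem_iInter.1 ht (t + 1)
    rw [Set.mem_Ici] at this
    linarith
  rw [h3, measure_empty] at h2
  exact h2.congr h1

/-- A function on `[0, ∞)` whose increments are controlled by an integrable density converges at
infinity, and the tails of the density control the distance to the limit. -/
theorem exists_tendsto_of_increment_le {U : ℝ → ℝ} {h : ℝ → ℝ≥0∞}
    (hfin : ∫⁻ t in Set.Ici 0, h t ≠ ∞)
    (hU : ∀ s t, 0 ≤ s → s ≤ t → ENNReal.ofReal |U s - U t| ≤ ∫⁻ τ in Set.Icc s t, h τ) :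
    ∃ l, Tendsto U atTop (𝓝 l) ∧
      ∀ s, 0 ≤ s → ENNReal.ofReal |U s - l| ≤ ∫⁻ τ in Set.Ici s, h τ := by
  have hfin' : ∀ s, 0 ≤ s → ∫⁻ t in Set.Ici s, h t ≠ ∞ := fun s hs =>
    ne_top_of_le_ne_top hfin (lintegral_mono_set (Set.Ici_subset_Ici.2 hs))
  have hUI : ∀ s t, 0 ≤ s → s ≤ t → ENNReal.ofReal |U s - U t| ≤ ∫⁻ τ in Set.Ici s, h τ :=
    fun s t hs hst => (hU s t hs hst).trans (lintegral_mono_set Set.Icc_subset_Ici_self)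
  have hmax : (fun t : ℝ => max t 0) =ᶠ[atTop] id := by
    filter_upwards [eventually_ge_atTop 0] with t ht using max_eq_left ht
  have hmaxT : Tendsto (fun t : ℝ => max t 0) atTop atTop := tendsto_id.congr' hmax.symm
  have hC : CauchySeq fun t : ℝ => U (max t 0) := by
    refine cauchySeq_of_le_tendsto_0' (fun s => (∫⁻ t in Set.Ici (max s 0), h t).toReal) ?_ ?_
    · intro s t hst
      have h0 : 0 ≤ max s 0 := le_max_right _ _
      rw [Real.dist_eq]
      exact (ENNReal.ofReal_le_iff_le_toReal (hfin' _ h0)).1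
        (hUI _ _ h0 (max_le_max_right 0 hst))
    · have := (tendsto_setLIntegral_Ici_zero hfin).comp hmaxT
      exact (ENNReal.tendsto_toReal ENNReal.zero_ne_top).comp this
  obtain ⟨l, hl⟩ := cauchySeq_tendsto_of_complete hC
  have hl' : Tendsto U atTop (𝓝 l) := by
    refine hl.congr' ?_
    filter_upwards [hmax] with t ht
    rw [ht]
    rfl
  refine ⟨l, hl', fun s hs => ?_⟩
  have hlim : Tendsto (fun t => ENNReal.ofReal |U s - U t|) atTop
      (𝓝 (ENNReal.ofReal |U s - l|)) :=
    ENNReal.tendsto_ofReal (tendsto_const_nhds.sub hl').abs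
  refine le_of_tendsto hlim ?_
  filter_upwards [eventually_ge_atTop s] with t ht using hUI s t hs ht

namespace RegularTree

variable {K : ℕ}

theorem ofReal_exp_le_rayWeight {ε lam C t : ℝ} (hlam : 0 < lam) (hC : 0 < C) (ht : 0 ≤ t) :
    ENNReal.ofReal (Real.exp (-ε * t)) ≤
      ENNReal.ofReal (C ^ (-lam)) * rayWeight ε lam C t := by
  rw [rayWeight, ← ENNReal.ofReal_mul (by positivity)]
  refine ENNReal.ofReal_le_ofReal ?_
  have h1 : C ^ lam ≤ (t + C) ^ lam := Real.rpow_le_rpow hC.le (by linarith) hlam.le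
  calc Real.exp (-ε * t) = C ^ (-lam) * (Real.exp (-ε * t) * C ^ lam) := by
        rw [Real.rpow_neg hC.le]
        have : 0 < C ^ lam := by positivity
        field_simp
    _ ≤ _ := by gcongr

theorem setLIntegral_ray_exp_le {ε lam C : ℝ} (hlam : 0 < lam) (hC : 0 < C)
    (g : RegularTree K → ℝ≥0∞) (ξ : TreeBoundary K) :
    ∫⁻ t in Set.Ici 0, g (ray ξ t) * ENNReal.ofReal (Real.exp (-ε * t)) ≤
      ENNReal.ofReal (C ^ (-lam)) * ∫⁻ t in Set.Ici 0, g (ray ξ t) * rayWeight ε lam C t := by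
  rw [← lintegral_const_mul' _ _ ENNReal.ofReal_ne_top]
  refine setLIntegral_mono' measurableSet_Ici fun t ht => ?_
  rw [mul_left_comm]
  gcongr
  exact ofReal_exp_le_rayWeight hlam hC ht

/-- A function with an integrable upper gradient has limits along almost all rays. -/
theorem IsUpperGradient.ae_exists_tendsto [NeZero K] {β ε lam C : ℝ} (hε : 0 < ε)
    (hβ : β - Real.log K = ε) (hlam : 0 < lam) (hC : 0 < C) {ν : Measure (TreeBoundary K)}
    (hν : IsAhlforsRegular ε (Real.log (K : ℝ) / ε) ν)
    {u : RegularTree K → ℝ} {g : RegularTree K → ℝ≥0∞} (h : IsUpperGradient ε u g)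
    (hg : ∫⁻ z, g z ∂(weightedMeasure K β lam C) ≠ ∞) :
    ∀ᵐ ξ ∂ν, ∃ l, Tendsto (fun t : ℝ => u (ray ξ t)) atTop (𝓝 l) ∧ ∀ s, 0 ≤ s →
      ENNReal.ofReal |u (ray ξ s) - l| ≤
        ∫⁻ t in Set.Ici s, g (ray ξ t) * ENNReal.ofReal (Real.exp (-ε * t)) := by
  obtain ⟨A, hA⟩ := exists_lintegral_weightedMeasure_bounds (lam := lam) (C := C) hε hβ hν
  have hm : Measurable fun ξ : TreeBoundary K =>
      ∫⁻ t in Set.Ici 0, g (ray ξ t) * rayWeight ε lam C t := by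
    have := measurable_lintegral_ray (K := K) fun z => g z * rayWeight ε lam C z.height
    convert this using 2 with ξ
    exact setLIntegral_congr_fun measurableSet_Ici fun t ht => by simp only [ray_height ξ ht]
  have hfin := ae_lt_top hm
    (ne_top_of_le_ne_top (ENNReal.mul_ne_top ENNReal.coe_ne_top hg) (hA g h.1).1)
  filter_upwards [hfin] with ξ hξ
  refine exists_tendsto_of_increment_le ?_ fun s t hs hst => h.ofReal_abs_sub_ray_le ξ hs hst
  exact ne_top_of_le_ne_top (ENNReal.mul_ne_top ENNReal.ofReal_ne_top hξ.ne)
    (setLIntegral_ray_exp_le hlam hC g ξ)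

end RegularTree

/-! ### Averages over dyadic sets -/

section Averages

variable {K : ℕ} {ν : Measure (TreeBoundary K)}

/-- The average of `f` over the dyadic set `I_x`. -/
noncomputable def dyadicAverage (ν : Measure (TreeBoundary K)) (f : TreeBoundary K → ℝ)
    (x : List (Fin K)) : ℝ :=
  ⨍ ξ in dyadicSet x, f ξ ∂ν

theorem besovEnergy_eq_tsum_lintegral {lam : ℝ} {α : ℕ → ℕ} (hα : Monotone α)
    (f : TreeBoundary K → ℝ) :
    besovEnergy lam α ν f = ∑' n, ENNReal.ofReal ((α (n + 1) : ℝ) ^ lam) *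
      ∫⁻ ξ, ENNReal.ofReal |dyadicAverage ν f (ξ.vertex (α (n + 1))) -
        dyadicAverage ν f (ξ.vertex (α n))| ∂ν := by
  refine tsum_congr fun n => congrArg _ ?_
  refine (TreeBoundary.lintegral_comp_vertex ν (α (n + 1)) fun x =>
    ENNReal.ofReal |dyadicAverage ν f x - dyadicAverage ν f (x.take (α n))|).symm.trans ?_
  refine lintegral_congr fun ξ => ?_
  rw [ξ.take_vertex (hα n.le_succ)]

theorem ofReal_abs_setAverage_sub_le {Ω : Type*} [MeasurableSpace Ω] {ν : Measure Ω} {S : Set Ω}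
    (hS0 : ν S ≠ 0) (hS : ν S ≠ ∞) {φ : Ω → ℝ} (hφ : IntegrableOn φ S ν) (c : ℝ) :
    ENNReal.ofReal |(⨍ ξ in S, φ ξ ∂ν) - c| ≤
      (ν S)⁻¹ * ∫⁻ ξ in S, ENNReal.ofReal |φ ξ - c| ∂ν := by
  have h1 : (⨍ ξ in S, φ ξ ∂ν) - c = (ν.real S)⁻¹ * ∫ ξ in S, (φ ξ - c) ∂ν := by
    have : ν.real S ≠ 0 := (ENNReal.toReal_pos hS0 hS).ne'
    rw [setAverage_eq, integral_sub hφ (integrableOn_const hS), setIntegral_const, smul_eq_mul,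
      smul_eq_mul]
    field_simp
  rw [h1, abs_mul, ENNReal.ofReal_mul (abs_nonneg _)]
  gcongr
  · rw [abs_of_nonneg (by positivity), measureReal_def, ← ENNReal.toReal_inv,
      ENNReal.ofReal_toReal (ENNReal.inv_ne_top.2 hS0)]
  · rw [← Real.enorm_eq_ofReal_abs]
    refine (enorm_integral_le_lintegral_enorm _).trans_eq ?_
    simp only [Real.enorm_eq_ofReal_abs]

theorem lintegral_dyadic_laverage [IsFiniteMeasure ν]
    (hν0 : ∀ x : List (Fin K), ν (dyadicSet x) ≠ 0) (D : TreeBoundary K → ℝ≥0∞) (n : ℕ) :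
    ∫⁻ ξ, (ν (dyadicSet (ξ.vertex n)))⁻¹ * ∫⁻ ζ in dyadicSet (ξ.vertex n), D ζ ∂ν ∂ν =
      ∫⁻ ξ, D ξ ∂ν := by
  rw [TreeBoundary.lintegral_comp_vertex ν n fun x =>
      (ν (dyadicSet x))⁻¹ * ∫⁻ ζ in dyadicSet x, D ζ ∂ν,
    TreeBoundary.lintegral_eq_sum_dyadicSet ν n D]
  refine Finset.sum_congr rfl fun x _ => ?_
  rw [← mul_assoc, ENNReal.mul_inv_cancel (hν0 _) (measure_ne_top _ _), one_mul]

theorem IsAhlforsRegular.measure_dyadicSet_ne_zero [NeZero K] {ε : ℝ} (hε : 0 < ε)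
    (hν : IsAhlforsRegular ε (Real.log (K : ℝ) / ε) ν) (x : List (Fin K)) :
    ν (dyadicSet x) ≠ 0 := by
  obtain ⟨A, hA, h⟩ := TreeBoundary.exists_measure_dyadicSet_bounds hε hν
  have key : ∀ x : List (Fin K), x ≠ [] → ν (dyadicSet x) ≠ 0 := by
    intro x hx h0
    have := (h x hx).2
    rw [h0, mul_zero, nonpos_iff_eq_zero, ENNReal.ofReal_eq_zero] at this
    exact (Real.exp_pos _).not_ge this
  by_cases hx : x = []
  · subst hx
    refine fun h0 => key [0] (by simp) (measure_mono_null (fun ξ _ => ?_) h0)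
    rfl
  · exact key x hx

theorem IsAhlforsRegular.isFiniteMeasure [NeZero K] {ε : ℝ} (hε : 0 < ε)
    (hν : IsAhlforsRegular ε (Real.log (K : ℝ) / ε) ν) : IsFiniteMeasure ν := by
  obtain ⟨A, hA, h⟩ := TreeBoundary.exists_measure_dyadicSet_bounds hε hν
  refine ⟨?_⟩
  have h1 := TreeBoundary.lintegral_comp_vertex ν 1 fun _ => 1
  rw [lintegral_one] at h1
  rw [h1]
  refine ENNReal.sum_lt_top.2 fun x _ => ?_
  rw [mul_one]
  refine ((h x.toList ?_).1).trans_lt ENNReal.ofReal_lt_top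
  intro h0
  have := x.toList_length
  rw [h0] at this
  simp at this

/-- If `φ` stays within `D` of a function of the vertex of level `n`, then the averages of `φ` at
the levels `n` and `m ≥ n` differ by at most `2 ∫ D` in `L¹`. -/
theorem lintegral_abs_dyadicAverage_sub_le [IsFiniteMeasure ν]
    (hν0 : ∀ x : List (Fin K), ν (dyadicSet x) ≠ 0) {φ : TreeBoundary K → ℝ}
    (hφ : Integrable φ ν) {n m : ℕ} (hnm : n ≤ m) (U : List (Fin K) → ℝ)
    {D : TreeBoundary K → ℝ≥0∞} (hD : ∀ᵐ ζ ∂ν, ENNReal.ofReal |φ ζ - U (ζ.vertex n)| ≤ D ζ) :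
    ∫⁻ ξ, ENNReal.ofReal |dyadicAverage ν φ (ξ.vertex m) - dyadicAverage ν φ (ξ.vertex n)| ∂ν ≤
      2 * ∫⁻ ξ, D ξ ∂ν := by
  set L : ℕ → TreeBoundary K → ℝ≥0∞ := fun k ξ =>
    (ν (dyadicSet (ξ.vertex k)))⁻¹ * ∫⁻ ζ in dyadicSet (ξ.vertex k), D ζ ∂ν with hL
  have h1 : ∀ k, n ≤ k → ∀ ξ : TreeBoundary K,
      ENNReal.ofReal |dyadicAverage ν φ (ξ.vertex k) - U (ξ.vertex n)| ≤ L k ξ := by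
    intro k hk ξ
    refine (ofReal_abs_setAverage_sub_le (hν0 _) (measure_ne_top _ _) hφ.integrableOn _).trans ?_
    simp only [hL]
    gcongr 1
    refine setLIntegral_mono_ae' (TreeBoundary.measurableSet_dyadicSet _) ?_
    filter_upwards [hD] with ζ hζ hmem
    rw [TreeBoundary.mem_dyadicSet_vertex] at hmem
    rwa [← TreeBoundary.vertex_eq_mono hk hmem]
  have hLm : Measurable (L m) := TreeBoundary.measurable_comp_vertex m fun x =>
    (ν (dyadicSet x))⁻¹ * ∫⁻ ζ in dyadicSet x, D ζ ∂ν
  calc _ ≤ ∫⁻ ξ, (L m ξ + L n ξ) ∂ν := by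
        refine lintegral_mono fun ξ => ?_
        refine le_trans ?_ (add_le_add (h1 m hnm ξ) (h1 n le_rfl ξ))
        rw [← ENNReal.ofReal_add (abs_nonneg _) (abs_nonneg _)]
        refine ENNReal.ofReal_le_ofReal ?_
        rw [abs_sub_comm (dyadicAverage ν φ (ξ.vertex n))]
        exact abs_sub_le _ _ _
    _ = 2 * ∫⁻ ξ, D ξ ∂ν := by
        rw [lintegral_add_left hLm, two_mul]
        exact congrArg₂ _ (lintegral_dyadic_laverage hν0 D m) (lintegral_dyadic_laverage hν0 D n)

end Averages

/-! ### Lacunary sequences -/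

theorem IsLacunary.pos {α : ℕ → ℕ} (hα : IsLacunary α) (n : ℕ) : 0 < α n := by
  obtain ⟨_, _, _, _, h⟩ := hα
  exact (h n).1

theorem IsLacunary.strictMono {α : ℕ → ℕ} (hα : IsLacunary α) : StrictMono α := by
  obtain ⟨c₀, c₁, hc₀, -, h⟩ := hα
  refine strictMono_nat_of_lt_succ fun n => ?_
  have hn : (0 : ℝ) < α n := by exact_mod_cast (h n).1
  have h1 := (le_div_iff₀ hn).1 (h n).2.1
  have h2 : (α n : ℝ) < α (n + 1) := by nlinarith
  exact_mod_cast h2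

/-- By geometric growth, the sum of the weights `α(n+1)^λ` with `α(n) ≤ t` is comparable to its
last term. -/
theorem IsLacunary.exists_tsum_indicator_le {α : ℕ → ℕ} (hα : IsLacunary α) {lam : ℝ}
    (hlam : 0 < lam) :
    ∃ c : ℝ, 0 < c ∧ ∀ t : ℝ, 0 ≤ t →
      ∑' n, (Set.Ici (α n : ℝ)).indicator
        (fun _ => ENNReal.ofReal ((α (n + 1) : ℝ) ^ lam)) t ≤ ENNReal.ofReal (c * t ^ lam) := by
  obtain ⟨c₀, c₁, hc₀, hc, h⟩ := hα
  have hα0 : ∀ n, (0 : ℝ) < α n := fun n => by exact_mod_cast (h n).1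
  have hc₁ : 0 < c₁ := by linarith
  set q := c₀ ^ lam with hq
  have hq1 : 1 < q := Real.one_lt_rpow hc₀ hlam
  have hlow : ∀ n, q * (α n : ℝ) ^ lam ≤ (α (n + 1) : ℝ) ^ lam := fun n => by
    rw [hq, ← Real.mul_rpow (by linarith) (hα0 n).le]
    exact Real.rpow_le_rpow (mul_nonneg (by linarith) (hα0 n).le)
      ((le_div_iff₀ (hα0 n)).1 (h n).2.1) hlam.le
  have hup : ∀ n, (α (n + 1) : ℝ) ^ lam ≤ c₁ ^ lam * (α n : ℝ) ^ lam := fun n => by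
    rw [← Real.mul_rpow hc₁.le (hα0 n).le]
    exact Real.rpow_le_rpow (hα0 _).le ((div_le_iff₀ (hα0 n)).1 (h n).2.2) hlam.le
  have hsum : ∀ N, (q - 1) * ∑ n ∈ Finset.range N, (α (n + 1) : ℝ) ^ lam ≤
      c₁ ^ lam * (α N : ℝ) ^ lam := by
    intro N
    induction N with
    | zero => simpa using by positivity
    | succ N ih =>
      rw [Finset.sum_range_succ, mul_add]
      have h1 : (α (N + 1) : ℝ) ^ lam * (q - 1) ≤ (q - 1) * (c₁ ^ lam * (α N : ℝ) ^ lam) := by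
        rw [mul_comm]
        exact mul_le_mul_of_nonneg_left (hup N) (by linarith)
      have h2 := mul_le_mul_of_nonneg_left (hlow N) (by positivity : 0 ≤ c₁ ^ lam)
      nlinarith
  refine ⟨c₁ ^ lam * c₁ ^ lam / (q - 1), by
    have : 0 < q - 1 := by linarith
    positivity, fun t ht => ENNReal.tsum_le_of_sum_range_le fun N => ?_⟩
  induction N with
  | zero => simp
  | succ N ih =>
    by_cases htN : (α N : ℝ) ≤ t
    · calc ∑ n ∈ Finset.range (N + 1), (Set.Ici (α n : ℝ)).indicator
            (fun _ => ENNReal.ofReal ((α (n + 1) : ℝ) ^ lam)) t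
          ≤ ∑ n ∈ Finset.range (N + 1), ENNReal.ofReal ((α (n + 1) : ℝ) ^ lam) :=
            Finset.sum_le_sum fun n _ => Set.indicator_le_self _ _ _
        _ = ENNReal.ofReal (∑ n ∈ Finset.range (N + 1), (α (n + 1) : ℝ) ^ lam) :=
            (ENNReal.ofReal_sum_of_nonneg fun n _ => by positivity).symm
        _ ≤ _ := by
          refine ENNReal.ofReal_le_ofReal ?_
          rw [div_mul_eq_mul_div, le_div_iff₀ (by linarith), mul_comm, mul_assoc]
          refine (hsum (N + 1)).trans ?_
          have h3 : (α N : ℝ) ^ lam ≤ t ^ lam := Real.rpow_le_rpow (hα0 N).le htN hlam.le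
          gcongr
          exact (hup N).trans (by gcongr)
    · rw [Finset.sum_range_succ, Set.indicator_of_notMem (s := Set.Ici (α N : ℝ)) htN, add_zero]
      exact ih

/-! ### Boundedness of the trace -/

namespace RegularTree

variable {K : ℕ}

/-- The part of the integral of an upper gradient along a ray beyond height `α(n)` controls the
`n`-th term of the energy; summation over `n` produces the weight `(t + C)^λ`. -/
theorem exists_besovEnergy_le {ε lam C : ℝ} (hlam : 0 < lam) (hC : 0 < C) {α : ℕ → ℕ}
    (hα : IsLacunary α) {ν : Measure (TreeBoundary K)} [IsFiniteMeasure ν]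
    (hν0 : ∀ x : List (Fin K), ν (dyadicSet x) ≠ 0) :
    ∃ A : ℝ≥0, ∀ (u : RegularTree K → ℝ) (g : RegularTree K → ℝ≥0∞) (φ : TreeBoundary K → ℝ),
      Measurable g → Integrable φ ν →
      (∀ᵐ ξ ∂ν, ∀ s, 0 ≤ s → ENNReal.ofReal |u (ray ξ s) - φ ξ| ≤
        ∫⁻ t in Set.Ici s, g (ray ξ t) * ENNReal.ofReal (Real.exp (-ε * t))) →
      besovEnergy lam α ν φ ≤
        A * ∫⁻ ξ, (∫⁻ t in Set.Ici 0, g (ray ξ t) * rayWeight ε lam C t) ∂ν := by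
  obtain ⟨c, hc, hsum⟩ := hα.exists_tsum_indicator_le hlam
  refine ⟨2 * Real.toNNReal c, fun u g φ hg hφ h => ?_⟩
  set a : ℕ → ℝ≥0∞ := fun n => ENNReal.ofReal ((α (n + 1) : ℝ) ^ lam) with ha
  set e : ℝ → ℝ≥0∞ := fun t => ENNReal.ofReal (Real.exp (-ε * t)) with he
  have hem : Measurable e := by
    rw [he]
    fun_prop
  set D : ℕ → TreeBoundary K → ℝ≥0∞ := fun n ξ =>
    ∫⁻ t in Set.Ici (α n : ℝ), g (ray ξ t) * e t with hD
  have hDi : ∀ n ξ, a n * D n ξ = ∫⁻ t in Set.Ici 0,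
      (Set.Ici (α n : ℝ)).indicator (fun _ => a n) t * (g (ray ξ t) * e t) := by
    intro n ξ
    have h1 : ∀ t, (Set.Ici (α n : ℝ)).indicator (fun _ => a n) t * (g (ray ξ t) * e t) =
        a n * (Set.Ici (α n : ℝ)).indicator (fun t => g (ray ξ t) * e t) t := by
      intro t
      by_cases ht : t ∈ Set.Ici (α n : ℝ) <;> simp [ht]
    simp only [h1]
    rw [lintegral_const_mul' _ _ ENNReal.ofReal_ne_top, lintegral_indicator measurableSet_Ici,
      Measure.restrict_restrict measurableSet_Ici,
      Set.inter_eq_left.2 (Set.Ici_subset_Ici.2 (Nat.cast_nonneg _))]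
  have hDm : ∀ n, Measurable fun ξ => a n * D n ξ := by
    intro n
    have := measurable_lintegral_ray (K := K) fun z =>
      (Set.Ici (α n : ℝ)).indicator (fun _ => a n) z.height * (g z * e z.height)
    convert this using 2 with ξ
    rw [hDi]
    exact setLIntegral_congr_fun measurableSet_Ici fun t ht => by simp only [ray_height ξ ht]
  have hterm : ∀ n, ∫⁻ ξ, ENNReal.ofReal |dyadicAverage ν φ (ξ.vertex (α (n + 1))) -
      dyadicAverage ν φ (ξ.vertex (α n))| ∂ν ≤ 2 * ∫⁻ ξ, D n ξ ∂ν := by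
    intro n
    refine lintegral_abs_dyadicAverage_sub_le hν0 hφ (hα.strictMono.monotone n.le_succ)
      (fun x => u (edgePoint x (α n))) ?_
    filter_upwards [h] with ξ hξ
    have := hξ (α n) (Nat.cast_nonneg _)
    rw [abs_sub_comm, edgePoint_vertex ξ ⟨Nat.cast_nonneg _, by simp⟩]
    exact this
  rw [besovEnergy_eq_tsum_lintegral hα.strictMono.monotone]
  calc ∑' n, a n * ∫⁻ ξ, ENNReal.ofReal |dyadicAverage ν φ (ξ.vertex (α (n + 1))) -
        dyadicAverage ν φ (ξ.vertex (α n))| ∂ν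
      ≤ ∑' n, 2 * ∫⁻ ξ, a n * D n ξ ∂ν := by
        refine ENNReal.tsum_le_tsum fun n => ?_
        rw [lintegral_const_mul' _ _ ENNReal.ofReal_ne_top, mul_left_comm]
        gcongr
        exact hterm n
    _ = 2 * ∫⁻ ξ, ∑' n, a n * D n ξ ∂ν := by
        rw [ENNReal.tsum_mul_left, lintegral_tsum fun n => (hDm n).aemeasurable]
    _ ≤ 2 * ∫⁻ ξ, (ENNReal.ofReal c *
          ∫⁻ t in Set.Ici 0, g (ray ξ t) * rayWeight ε lam C t) ∂ν := by
        gcongr with ξ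
        simp only [hDi]
        have hgm : Measurable fun t => g (ray ξ t) * e t := (hg.comp (measurable_ray ξ)).mul hem
        have hm : ∀ n, Measurable fun t =>
            (Set.Ici (α n : ℝ)).indicator (fun _ => a n) t * (g (ray ξ t) * e t) := fun n =>
          (measurable_const.indicator measurableSet_Ici).mul hgm
        rw [← lintegral_tsum fun n => (hm n).aemeasurable,
          ← lintegral_const_mul' _ _ ENNReal.ofReal_ne_top]
        refine setLIntegral_mono' measurableSet_Ici fun t ht => ?_
        rw [Set.mem_Ici] at ht
        rw [ENNReal.tsum_mul_right, mul_left_comm, mul_left_comm (ENNReal.ofReal c), mul_comm _ (e t)]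
        gcongr 1
        refine (mul_le_mul_right (hsum t ht) _).trans ?_
        simp only [he, rayWeight]
        rw [← ENNReal.ofReal_mul (Real.exp_pos _).le, ← ENNReal.ofReal_mul hc.le]
        refine ENNReal.ofReal_le_ofReal ?_
        rw [mul_left_comm]
        have : t ^ lam ≤ (t + C) ^ lam := Real.rpow_le_rpow ht (by linarith) hlam.le
        gcongr
    _ = _ := by
        rw [lintegral_const_mul' _ _ ENNReal.ofReal_ne_top, ← mul_assoc]
        rfl

/-- The value of the trace at `ξ` is compared with the values of `u` on the first edge of the
ray `[0, ξ)`. -/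
theorem lintegral_trace_le {ε lam C : ℝ} (hε : 0 < ε) (hlam : 0 < lam) (hC : 0 < C)
    {ν : Measure (TreeBoundary K)} {u : RegularTree K → ℝ} {g G : RegularTree K → ℝ≥0∞}
    {φ : TreeBoundary K → ℝ} (hG : Measurable G)
    (huG : ∀ z, ENNReal.ofReal |u z| ≤ G z)
    (h : ∀ᵐ ξ ∂ν, ∀ s, 0 ≤ s → ENNReal.ofReal |u (ray ξ s) - φ ξ| ≤
      ∫⁻ t in Set.Ici s, g (ray ξ t) * ENNReal.ofReal (Real.exp (-ε * t))) :
    ∫⁻ ξ, ENNReal.ofReal |φ ξ| ∂ν ≤ ENNReal.ofReal (Real.exp ε * C ^ (-lam)) *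
      ∫⁻ ξ, (∫⁻ t in Set.Ici 0, (G + g) (ray ξ t) * rayWeight ε lam C t) ∂ν := by
  rw [← lintegral_const_mul' _ _ ENNReal.ofReal_ne_top]
  refine lintegral_mono_ae ?_
  filter_upwards [h] with ξ hξ
  set D := ∫⁻ t in Set.Ici 0, g (ray ξ t) * ENNReal.ofReal (Real.exp (-ε * t)) with hD
  have h1 : ∀ t, 0 ≤ t → ENNReal.ofReal |φ ξ| ≤ G (ray ξ t) + D := by
    intro t ht
    calc ENNReal.ofReal |φ ξ|
        ≤ ENNReal.ofReal (|u (ray ξ t)| + |u (ray ξ t) - φ ξ|) := by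
          refine ENNReal.ofReal_le_ofReal ?_
          have := abs_sub_abs_le_abs_sub (φ ξ) (u (ray ξ t))
          rw [abs_sub_comm (φ ξ)] at this
          linarith
      _ = ENNReal.ofReal |u (ray ξ t)| + ENNReal.ofReal |u (ray ξ t) - φ ξ| :=
          ENNReal.ofReal_add (abs_nonneg _) (abs_nonneg _)
      _ ≤ _ := by
          gcongr
          · exact huG _
          · exact (hξ t ht).trans (lintegral_mono_set (Set.Ici_subset_Ici.2 ht))
  have hGm : Measurable fun t => G (ray ξ t) := hG.comp (measurable_ray ξ)
  have hexp : (1 : ℝ) ≤ Real.exp ε := Real.one_le_exp hε.le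
  have hwG : ∫⁻ t in Set.Ioc (0 : ℝ) 1, G (ray ξ t) ≤
      ENNReal.ofReal (Real.exp ε * C ^ (-lam)) *
        ∫⁻ t in Set.Ici 0, G (ray ξ t) * rayWeight ε lam C t := by
    rw [← lintegral_const_mul' _ _ ENNReal.ofReal_ne_top]
    refine (setLIntegral_mono' measurableSet_Ioc fun t ht => ?_).trans
      (lintegral_mono_set fun t ht => ht.1.le)
    have h2 : ENNReal.ofReal (Real.exp (-ε)) ≤ ENNReal.ofReal (Real.exp (-ε * t)) := by
      refine ENNReal.ofReal_le_ofReal (Real.exp_le_exp.2 ?_)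
      nlinarith [ht.1, ht.2]
    have h3 : 1 ≤ ENNReal.ofReal (Real.exp ε * C ^ (-lam)) * rayWeight ε lam C t := by
      calc (1 : ℝ≥0∞) = ENNReal.ofReal (Real.exp ε) * ENNReal.ofReal (Real.exp (-ε)) := by
            rw [← ENNReal.ofReal_mul (Real.exp_pos _).le, ← Real.exp_add]
            simp
        _ ≤ ENNReal.ofReal (Real.exp ε) *
            (ENNReal.ofReal (C ^ (-lam)) * rayWeight ε lam C t) := by
            gcongr
            exact h2.trans (ofReal_exp_le_rayWeight hlam hC ht.1.le)
        _ = _ := by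
            rw [ENNReal.ofReal_mul (Real.exp_pos _).le, mul_assoc]
    calc G (ray ξ t) ≤ G (ray ξ t) *
          (ENNReal.ofReal (Real.exp ε * C ^ (-lam)) * rayWeight ε lam C t) :=
          le_mul_of_one_le_right' h3
      _ = _ := by ring
  have hDle : D ≤ ENNReal.ofReal (Real.exp ε * C ^ (-lam)) *
      ∫⁻ t in Set.Ici 0, g (ray ξ t) * rayWeight ε lam C t := by
    refine (setLIntegral_ray_exp_le hlam hC g ξ).trans ?_
    gcongr
    exact le_mul_of_one_le_left (by positivity) hexp
  calc ENNReal.ofReal |φ ξ| = ∫⁻ t in Set.Ioc (0 : ℝ) 1, ENNReal.ofReal |φ ξ| := by simp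
    _ ≤ ∫⁻ t in Set.Ioc (0 : ℝ) 1, (G (ray ξ t) + D) :=
        setLIntegral_mono' measurableSet_Ioc fun t ht => h1 t ht.1.le
    _ = (∫⁻ t in Set.Ioc (0 : ℝ) 1, G (ray ξ t)) + D := by
        rw [lintegral_add_left hGm]
        simp
    _ ≤ _ := add_le_add hwG hDle
    _ = _ := by
        have hm : Measurable fun t => G (ray ξ t) * rayWeight ε lam C t :=
          hGm.mul (measurable_rayWeight ε lam C)
        rw [← mul_add, ← lintegral_add_left hm]
        simp only [Pi.add_apply, add_mul]

/-- The Besov norm of the trace is bounded by the Newtonian norm. -/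
theorem exists_besovNorm_trace_le [NeZero K] {β ε lam C : ℝ} (hε : 0 < ε)
    (hβ : β - Real.log K = ε) (hlam : 0 < lam) (hC : 0 < C) {α : ℕ → ℕ} (hα : IsLacunary α)
    {ν : Measure (TreeBoundary K)} (hν : IsAhlforsRegular ε (Real.log (K : ℝ) / ε) ν) :
    ∃ A : ℝ≥0, ∀ (u : RegularTree K → ℝ) (φ : TreeBoundary K → ℝ),
      AEStronglyMeasurable u (weightedMeasure K β lam C) →
      newtonNorm ε (weightedMeasure K β lam C) u < ∞ → AEStronglyMeasurable φ ν →
      (∀ᵐ ξ ∂ν, Tendsto (fun t : ℝ => u (ray ξ t)) atTop (𝓝 (φ ξ))) →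
      besovNorm lam α ν φ ≤ A * newtonNorm ε (weightedMeasure K β lam C) u := by
  have hfin := hν.isFiniteMeasure hε
  obtain ⟨A₁, hA₁⟩ := exists_lintegral_weightedMeasure_bounds (lam := lam) (C := C) hε hβ hν
  obtain ⟨A₂, hA₂⟩ := exists_besovEnergy_le (ε := ε) hlam hC hα
    (hν.measure_dyadicSet_ne_zero hε)
  set μ := weightedMeasure K β lam C with hμ
  set κ : ℝ≥0 := Real.toNNReal (Real.exp ε * C ^ (-lam)) with hκ
  set A : ℝ≥0 := (κ + A₂) * A₁ + 1 with hAdef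
  refine ⟨A, fun u φ hu hunorm hφm hlim => ?_⟩
  have hufin := (newtonNorm_lt_top_iff.1 hunorm).1
  -- a Borel majorant of `|u|` with the same integral
  obtain ⟨G, hG, huG, hGint⟩ : ∃ G : RegularTree K → ℝ≥0∞, Measurable G ∧
      (∀ z, ENNReal.ofReal |u z| ≤ G z) ∧ ∫⁻ z, G z ∂μ = ∫⁻ z, ENNReal.ofReal |u z| ∂μ := by
    have hum : AEMeasurable (fun z => ENNReal.ofReal |u z|) μ :=
      (hu.norm.aemeasurable).ennreal_ofReal
    set N := toMeasurable μ {z | ENNReal.ofReal |u z| ≠ hum.mk _ z} with hN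
    have hN0 : μ N = 0 := by
      rw [hN, measure_toMeasurable]
      exact hum.ae_eq_mk
    have hNm : MeasurableSet N := measurableSet_toMeasurable _ _
    refine ⟨fun z => hum.mk _ z + N.indicator (fun _ => ∞) z,
      hum.measurable_mk.add (measurable_const.indicator hNm), fun z => ?_, ?_⟩
    · by_cases hz : z ∈ N
      · simp [hz]
      · have : ENNReal.ofReal |u z| = hum.mk _ z := by
          by_contra h
          exact hz (subset_toMeasurable _ _ h)
        rw [this]
        exact le_self_add
    · rw [lintegral_add_left hum.measurable_mk, lintegral_indicator_const hNm, hN0, mul_zero,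
        add_zero]
      exact lintegral_congr_ae hum.ae_eq_mk.symm
  have key : ∀ g, IsUpperGradient ε u g →
      besovNorm lam α ν φ ≤ A * (∫⁻ z, ENNReal.ofReal |u z| ∂μ + ∫⁻ z, g z ∂μ) := by
    intro g hg
    by_cases hgfin : ∫⁻ z, g z ∂μ = ∞
    · have hA0 : (A : ℝ≥0∞) ≠ 0 := by
        rw [hAdef]
        simp
      rw [hgfin, add_top, ENNReal.mul_top hA0]
      exact le_top
    have hae : ∀ᵐ ξ ∂ν, ∀ s, 0 ≤ s → ENNReal.ofReal |u (ray ξ s) - φ ξ| ≤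
        ∫⁻ t in Set.Ici s, g (ray ξ t) * ENNReal.ofReal (Real.exp (-ε * t)) := by
      filter_upwards [hlim, hg.ae_exists_tendsto hε hβ hlam hC hν hgfin] with ξ h1 ⟨l, h2, h3⟩
      rwa [tendsto_nhds_unique h1 h2]
    have hL1 := lintegral_trace_le hε hlam hC hG huG hae
    have hL2 : ∫⁻ ξ, ENNReal.ofReal |φ ξ| ∂ν ≤
        κ * (A₁ * (∫⁻ z, ENNReal.ofReal |u z| ∂μ + ∫⁻ z, g z ∂μ)) := by
      refine hL1.trans ?_
      rw [← hGint, ← lintegral_add_left hG]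
      exact mul_le_mul_right (hA₁ _ (hG.add hg.1)).1 _
    have heL : eLpNorm φ 1 ν = ∫⁻ ξ, ENNReal.ofReal |φ ξ| ∂ν := by
      simp only [eLpNorm_one_eq_lintegral_enorm, Real.enorm_eq_ofReal_abs]
    have hφ : Integrable φ ν := by
      rw [← memLp_one_iff_integrable]
      refine ⟨hφm, ?_⟩
      rw [heL]
      refine hL2.trans_lt (ENNReal.mul_lt_top ENNReal.coe_lt_top
        (ENNReal.mul_lt_top ENNReal.coe_lt_top (ENNReal.add_lt_top.2 ⟨hufin, ?_⟩)))
      exact lt_top_iff_ne_top.2 hgfin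
    have hE : besovEnergy lam α ν φ ≤
        A₂ * (A₁ * (∫⁻ z, ENNReal.ofReal |u z| ∂μ + ∫⁻ z, g z ∂μ)) := by
      refine (hA₂ u g φ hg.1 hφ hae).trans ?_
      gcongr
      exact (hA₁ g hg.1).1.trans (mul_le_mul_right le_add_self _)
    calc besovNorm lam α ν φ ≤ _ := add_le_add (heL.trans_le hL2) hE
      _ = ((κ + A₂) * A₁) * (∫⁻ z, ENNReal.ofReal |u z| ∂μ + ∫⁻ z, g z ∂μ) := by ring
      _ ≤ _ := by
          gcongr
          rw [hAdef]
          push_cast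
          exact le_self_add
  have hA0 : (A : ℝ≥0∞) ≠ 0 := by
    rw [hAdef]
    simp
  rw [newtonNorm, ← ENNReal.div_le_iff' hA0 ENNReal.coe_ne_top, ← tsub_le_iff_left]
  refine le_iInf₂ fun g hg => ?_
  rw [tsub_le_iff_left, ENNReal.div_le_iff' hA0 ENNReal.coe_ne_top]
  exact key g hg

/-- Every function of the Newtonian space has a trace in the Besov space. -/
theorem exists_trace [NeZero K] {β ε lam C : ℝ} (hε : 0 < ε)
    (hβ : β - Real.log K = ε) (hlam : 0 < lam) (hC : 0 < C) {α : ℕ → ℕ} (hα : IsLacunary α)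
    {ν : Measure (TreeBoundary K)} (hν : IsAhlforsRegular ε (Real.log (K : ℝ) / ε) ν)
    (u : newtonSpace ε (weightedMeasure K β lam C)) :
    ∃ φ : besovSpace lam α ν, ∀ᵐ ξ ∂ν,
      Tendsto (fun t : ℝ => (u : RegularTree K → ℝ) (ray ξ t)) atTop
        (𝓝 ((φ : Lp ℝ 1 ν) ξ)) := by
  obtain ⟨u, hu, hunorm⟩ := u
  obtain ⟨-, g, hg, hgfin⟩ := newtonNorm_lt_top_iff.1 hunorm
  have hae := hg.ae_exists_tendsto hε hβ hlam hC hν hgfin.ne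
  have hmeas : ∀ n : ℕ, Measurable fun ξ : TreeBoundary K => u (ray ξ n) := by
    intro n
    have := TreeBoundary.measurable_comp_vertex n fun x : List (Fin K) => u (edgePoint x n)
    convert this using 2 with ξ
    rw [edgePoint_vertex ξ ⟨Nat.cast_nonneg _, by simp⟩]
  obtain ⟨φ, hφm, hφ⟩ := measurable_limit_of_tendsto_metrizable_ae (L := atTop) (μ := ν)
    (fun n => (hmeas n).aemeasurable) (by
      filter_upwards [hae] with ξ ⟨l, hl, _⟩
      exact ⟨l, hl.comp tendsto_natCast_atTop_atTop⟩)
  have hφt : ∀ᵐ ξ ∂ν, Tendsto (fun t : ℝ => u (ray ξ t)) atTop (𝓝 (φ ξ)) := by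
    filter_upwards [hφ, hae] with ξ h1 ⟨l, hl, _⟩
    rwa [tendsto_nhds_unique h1 (hl.comp tendsto_natCast_atTop_atTop)]
  obtain ⟨A, hA⟩ := exists_besovNorm_trace_le hε hβ hlam hC hα hν
  have hb : besovNorm lam α ν φ < ∞ := (hA u φ hu hunorm hφm.aestronglyMeasurable hφt).trans_lt
    (ENNReal.mul_lt_top ENNReal.coe_lt_top hunorm)
  have hb' := ENNReal.add_lt_top.1 hb
  have hLp : MemLp φ 1 ν := ⟨hφm.aestronglyMeasurable, hb'.1⟩
  refine ⟨⟨hLp.toLp φ, ?_⟩, ?_⟩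
  · change besovEnergy lam α ν (hLp.toLp φ) < ∞
    rw [besovEnergy_congr hLp.coeFn_toLp]
    exact hb'.2
  · filter_upwards [hφt, hLp.coeFn_toLp] with ξ h1 h2
    rw [h2]
    exact h1

end RegularTree

/-! ### Functions with prescribed increments along the edges -/

theorem intervalIntegrable_comp_ceil (b : ℕ → ℝ) (x y : ℝ) :
    IntervalIntegrable (fun τ : ℝ => b ⌈τ⌉₊) volume x y := by
  have hm : Measurable fun τ : ℝ => b ⌈τ⌉₊ :=
    (Measurable.of_discrete (f := b)).comp Nat.measurable_ceil
  rw [intervalIntegrable_iff]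
  refine Measure.integrableOn_of_bounded (M := ∑ i ∈ Finset.range (⌈max x y⌉₊ + 1), ‖b i‖)
    (by simp [Set.uIoc]) hm.aestronglyMeasurable ?_
  refine (ae_restrict_mem measurableSet_uIoc).mono fun τ hτ => ?_
  have hτ' : ⌈τ⌉₊ ≤ ⌈max x y⌉₊ := Nat.ceil_mono hτ.2
  exact Finset.single_le_sum (f := fun i => ‖b i‖) (fun i _ => norm_nonneg _)
    (Finset.mem_range.2 (by omega))

theorem integral_comp_ceil_natCast (b : ℕ → ℝ) (N : ℕ) :
    ∫ τ in (0 : ℝ)..N, b ⌈τ⌉₊ = ∑ m ∈ Finset.range N, b (m + 1) := by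
  have h := intervalIntegral.sum_integral_adjacent_intervals (n := N)
    (f := fun τ : ℝ => b ⌈τ⌉₊) (μ := volume) (a := fun k : ℕ => (k : ℝ))
    fun k _ => intervalIntegrable_comp_ceil b _ _
  rw [Nat.cast_zero] at h
  rw [← h]
  refine Finset.sum_congr rfl fun m _ => ?_
  rw [intervalIntegral.integral_of_le (by simp)]
  have h1 : ∀ τ ∈ Set.Ioc (m : ℝ) ((m + 1 : ℕ) : ℝ), b ⌈τ⌉₊ = b (m + 1) := by
    intro τ hτ
    rw [Nat.cast_add_one, ← edgeHeights_succ] at hτ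
    rw [hτ.2]
  rw [setIntegral_congr_fun measurableSet_Ioc h1, setIntegral_const]
  simp

namespace RegularTree

variable {K : ℕ}

/-- The function on the tree that vanishes at the root and has slope `s x`, in terms of the height,
along the edge with lower end point `x`. -/
noncomputable def primitive (s : List (Fin K) → ℝ) (z : RegularTree K) : ℝ :=
  ∫ τ in (0 : ℝ)..z.height, s (z.word.take ⌈τ⌉₊)

theorem primitive_ray (s : List (Fin K) → ℝ) (ξ : TreeBoundary K) {t : ℝ} (ht : 0 ≤ t) :
    primitive s (ray ξ t) = ∫ τ in (0 : ℝ)..t, s (ξ.vertex ⌈τ⌉₊) := by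
  rw [primitive, ray_height ξ ht, ray_word ξ ht]
  refine intervalIntegral.integral_congr fun τ hτ => ?_
  rw [Set.uIcc_of_le ht] at hτ
  simp only [ξ.take_vertex (Nat.ceil_mono hτ.2)]

theorem primitive_ray_natCast (s : List (Fin K) → ℝ) (ξ : TreeBoundary K) (N : ℕ) :
    primitive s (ray ξ N) = ∑ m ∈ Finset.range N, s (ξ.vertex (m + 1)) := by
  rw [primitive_ray s ξ (Nat.cast_nonneg N), integral_comp_ceil_natCast fun n => s (ξ.vertex n)]

theorem primitive_ray_zero (s : List (Fin K) → ℝ) (ξ : TreeBoundary K) :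
    primitive s (ray ξ 0) = 0 := by
  rw [primitive_ray s ξ le_rfl, intervalIntegral.integral_same]

theorem primitive_add (s t : List (Fin K) → ℝ) : primitive (s + t) = primitive s + primitive t := by
  funext z
  exact intervalIntegral.integral_add
    (intervalIntegrable_comp_ceil (fun n => s (z.word.take n)) _ _)
    (intervalIntegrable_comp_ceil (fun n => t (z.word.take n)) _ _)

theorem primitive_smul (c : ℝ) (s : List (Fin K) → ℝ) : primitive (c • s) = c • primitive s := by
  funext z
  exact intervalIntegral.integral_const_mul c _

theorem measurable_primitive (s : List (Fin K) → ℝ) : Measurable (primitive s) :=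
  measurable_of_edges (F := fun w h => ∫ τ in (0 : ℝ)..h, s (w.take ⌈τ⌉₊)) fun w =>
    (intervalIntegral.continuous_primitive (fun a b =>
      intervalIntegrable_comp_ceil (fun n => s (w.take n)) a b) 0).measurable

/-- An upper gradient of `primitive s`: as `ds_X = e^{-ε|z|} d|z|`, the slope in terms of
the arc length is the slope in terms of the height, times `e^{ε|z|}`. -/
noncomputable def primitiveGradient (ε : ℝ) (s : List (Fin K) → ℝ) (z : RegularTree K) : ℝ≥0∞ :=
  ENNReal.ofReal |s z.word| * ENNReal.ofReal (Real.exp (ε * z.height))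

theorem measurable_primitiveGradient (ε : ℝ) (s : List (Fin K) → ℝ) :
    Measurable (primitiveGradient ε s) :=
  measurable_of_edges (F := fun w h => ENNReal.ofReal |s w| * ENNReal.ofReal (Real.exp (ε * h)))
    fun w => by fun_prop

theorem primitiveGradient_ray_mul (ε : ℝ) (s : List (Fin K) → ℝ) (ξ : TreeBoundary K) {t : ℝ}
    (ht : 0 ≤ t) :
    primitiveGradient ε s (ray ξ t) * ENNReal.ofReal (Real.exp (-ε * t)) =
      ENNReal.ofReal |s (ξ.vertex ⌈t⌉₊)| := by
  rw [primitiveGradient, ray_height ξ ht, ray_word ξ ht, mul_assoc,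
    ← ENNReal.ofReal_mul (Real.exp_pos _).le, ← Real.exp_add]
  simp

theorem ofReal_abs_primitive_sub_le (ε : ℝ) (s : List (Fin K) → ℝ) (ξ : TreeBoundary K) {a b : ℝ}
    (ha : 0 ≤ a) (hab : a ≤ b) :
    ENNReal.ofReal |primitive s (ray ξ b) - primitive s (ray ξ a)| ≤
      ∫⁻ t in Set.Ioc a b,
        primitiveGradient ε s (ray ξ t) * ENNReal.ofReal (Real.exp (-ε * t)) := by
  rw [primitive_ray s ξ ha, primitive_ray s ξ (ha.trans hab),
    intervalIntegral.integral_interval_sub_left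
      (intervalIntegrable_comp_ceil (fun n => s (ξ.vertex n)) _ _)
      (intervalIntegrable_comp_ceil (fun n => s (ξ.vertex n)) _ _),
    intervalIntegral.integral_of_le hab, ← Real.enorm_eq_ofReal_abs]
  refine (enorm_integral_le_lintegral_enorm _).trans_eq ?_
  refine setLIntegral_congr_fun measurableSet_Ioc fun t ht => ?_
  simp only [primitiveGradient_ray_mul ε s ξ (ha.trans ht.1.le), Real.enorm_eq_ofReal_abs]

/-- Two rays run together up to some height, and separate for good after it. -/
theorem exists_branching_height (ξ ζ : TreeBoundary K) {a b : ℝ} (ha : 0 ≤ a) (hb : 0 ≤ b) :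
    ∃ m, 0 ≤ m ∧ m ≤ a ∧ m ≤ b ∧ ray ξ m = ray ζ m ∧
      ∀ h, 0 ≤ h → h ≤ a → h ≤ b → ray ξ h = ray ζ h → h ≤ m := by
  by_cases hξ : ξ = ζ
  · subst hξ
    exact ⟨min a b, le_min ha hb, min_le_left _ _, min_le_right _ _, rfl,
      fun h _ h1 h2 _ => le_min h1 h2⟩
  · have hk : ∀ h, 0 ≤ h → (ray ξ h = ray ζ h ↔ h ≤ (PiNat.firstDiff ξ ζ : ℝ)) := by
      intro h hh
      rw [ray_eq_iff hh, ray_height ξ hh, ray_word ξ hh, TreeBoundary.vertex_eq_iff,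
        ← Nat.ceil_le]
      constructor
      · rintro ⟨-, h2⟩
        by_contra hlt
        exact PiNat.apply_firstDiff_ne hξ (h2 _ (not_le.1 hlt))
      · exact fun h2 => ⟨rfl, fun i hi => PiNat.apply_eq_of_lt_firstDiff (hi.trans_le h2)⟩
    have h0 : 0 ≤ min (min a b) (PiNat.firstDiff ξ ζ : ℝ) :=
      le_min (le_min ha hb) (Nat.cast_nonneg _)
    refine ⟨min (min a b) (PiNat.firstDiff ξ ζ), h0, (min_le_left _ _).trans (min_le_left _ _),
      (min_le_left _ _).trans (min_le_right _ _), (hk _ h0).2 (min_le_right _ _),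
      fun h hh h1 h2 h3 => le_min (le_min h1 h2) ((hk h hh).1 h3)⟩

theorem isUpperGradient_primitive [NeZero K] (ε : ℝ) (s : List (Fin K) → ℝ) :
    IsUpperGradient ε (primitive s) (primitiveGradient ε s) := by
  have hg := measurable_primitiveGradient ε s
  refine ⟨hg, fun x y => ?_⟩
  obtain ⟨ξ, hx⟩ := exists_ray_eq x
  obtain ⟨ζ, hy⟩ := exists_ray_eq y
  have ha := x.height_nonneg
  have hb := y.height_nonneg
  generalize x.height = a at hx ha
  generalize y.height = b at hy hb
  subst hx hy
  obtain ⟨m, hm0, hma, hmb, hm, hmax⟩ := exists_branching_height ξ ζ ha hb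
  -- `ray ξ m` is the last common ancestor of the two points
  have hanc : ∀ w : RegularTree K, w ≤ ray ξ a → w ≤ ray ζ b →
      w.height ≤ m ∧ w = ray ξ w.height ∧ w = ray ζ w.height := by
    intro w h1 h2
    rw [le_ray_iff ha] at h1
    rw [le_ray_iff hb] at h2
    exact ⟨hmax _ w.height_nonneg h1.1 h2.1 (h1.2.symm.trans h2.2), h1.2, h2.2⟩
  have hsub1 : raySegment ξ (Set.Ioc m a) ⊆ geodesic (ray ξ a) (ray ζ b) := by
    rintro z ⟨hz, hzr⟩
    refine ⟨Or.inl ((le_ray_iff ha).2 ⟨hz.2, hzr⟩), fun w h1 h2 => ?_⟩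
    obtain ⟨h3, h4, -⟩ := hanc w h1 h2
    rw [hzr, le_ray_iff z.height_nonneg]
    exact ⟨h3.trans hz.1.le, h4⟩
  have hsub2 : raySegment ζ (Set.Ioc m b) ⊆ geodesic (ray ξ a) (ray ζ b) := by
    rintro z ⟨hz, hzr⟩
    refine ⟨Or.inr ((le_ray_iff hb).2 ⟨hz.2, hzr⟩), fun w h1 h2 => ?_⟩
    obtain ⟨h3, -, h4⟩ := hanc w h1 h2
    rw [hzr, le_ray_iff z.height_nonneg]
    exact ⟨h3.trans hz.1.le, h4⟩
  have hdisj : Disjoint (raySegment ξ (Set.Ioc m a)) (raySegment ζ (Set.Ioc m b)) := by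
    refine Set.disjoint_left.2 fun z h1 h2 => ?_
    exact (hmax _ z.height_nonneg h1.1.2 h2.1.2 (h1.2.symm.trans h2.2)).not_gt h1.1.1
  have hpos : ∀ c, Set.Ioc m c ⊆ Set.Ici 0 := fun c t ht => hm0.trans ht.1.le
  calc ENNReal.ofReal |primitive s (ray ξ a) - primitive s (ray ζ b)|
      ≤ ENNReal.ofReal (|primitive s (ray ξ a) - primitive s (ray ξ m)| +
          |primitive s (ray ζ b) - primitive s (ray ζ m)|) := by
        refine ENNReal.ofReal_le_ofReal ?_
        rw [abs_sub_comm (primitive s (ray ζ b)), hm]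
        exact abs_sub_le _ _ _
    _ = ENNReal.ofReal |primitive s (ray ξ a) - primitive s (ray ξ m)| +
          ENNReal.ofReal |primitive s (ray ζ b) - primitive s (ray ζ m)| :=
        ENNReal.ofReal_add (abs_nonneg _) (abs_nonneg _)
    _ ≤ _ := add_le_add (ofReal_abs_primitive_sub_le ε s ξ hm0 hma)
        (ofReal_abs_primitive_sub_le ε s ζ hm0 hmb)
    _ = ∫⁻ z in raySegment ξ (Set.Ioc m a) ∪ raySegment ζ (Set.Ioc m b),
          primitiveGradient ε s z ∂(arcLength K ε) := by
        rw [lintegral_union (measurableSet_raySegment ζ measurableSet_Ioc) hdisj,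
          setLIntegral_arcLength_raySegment ε ξ measurableSet_Ioc (hpos a) hg,
          setLIntegral_arcLength_raySegment ε ζ measurableSet_Ioc (hpos b) hg]
    _ ≤ _ := lintegral_mono_set (Set.union_subset hsub1 hsub2)

theorem lintegral_rayWeight_ne_top {ε lam C : ℝ} (hε : 0 < ε) (hC : 0 < C) :
    ∫⁻ t in Set.Ici 0, rayWeight ε lam C t ≠ ∞ := by
  have hint : IntegrableOn (fun t : ℝ => Real.exp (-ε * t) * (t + C) ^ lam) (Set.Ioi 0) := by
    refine integrable_of_isBigO_exp_neg (b := ε / 2) (by positivity) ?_ ?_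
    · refine ContinuousOn.mul (by fun_prop) ?_
      refine ContinuousOn.rpow_const (by fun_prop) fun t ht => Or.inl ?_
      have : 0 ≤ t := ht
      positivity
    · have h1 : (fun t : ℝ => (t + C) ^ lam) =O[atTop] fun t => Real.exp (ε / 2 * (t + C)) :=
        ((isLittleO_rpow_exp_pos_mul_atTop lam (half_pos hε)).comp_tendsto
          (tendsto_atTop_add_const_right _ C tendsto_id)).isBigO
      have h2 := (Asymptotics.isBigO_refl (fun t : ℝ => Real.exp (-ε * t)) atTop).mul h1
      have h3 : (fun t : ℝ => Real.exp (-ε * t) * Real.exp (ε / 2 * (t + C))) =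
          fun t => Real.exp (ε / 2 * C) * Real.exp (-(ε / 2) * t) := by
        funext t
        rw [← Real.exp_add, ← Real.exp_add]
        congr 1
        ring
      rw [h3] at h2
      exact h2.trans (Asymptotics.isBigO_const_mul_self _ _ _)
  rw [← integrableOn_Ici_iff_integrableOn_Ioi] at hint
  refine ne_top_of_le_ne_top hint.2.ne ?_
  refine lintegral_mono fun t => ?_
  rw [rayWeight, Real.enorm_eq_ofReal_abs]
  exact ENNReal.ofReal_le_ofReal (le_abs_self _)

/-- The Newtonian norm of `primitive s` is bounded by a weighted sum of the increments: there is no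
need to estimate the `L¹` norm separately, since the function vanishes at the root and the total
mass of the weight along a ray is finite. -/
theorem exists_newtonNorm_primitive_le [NeZero K] {β ε lam C : ℝ} (hε : 0 < ε)
    (hβ : β - Real.log K = ε) (hlam : 0 < lam) (hC : 0 < C) {ν : Measure (TreeBoundary K)}
    (hν : IsAhlforsRegular ε (Real.log (K : ℝ) / ε) ν) :
    ∃ A : ℝ≥0, ∀ s : List (Fin K) → ℝ,
      newtonNorm ε (weightedMeasure K β lam C) (primitive s) ≤
        A * ∑' n : ℕ, ENNReal.ofReal ((n + C) ^ lam) *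
          ∫⁻ ξ, (if n = 0 then 0 else ENNReal.ofReal |s (ξ.vertex n)|) ∂ν := by
  obtain ⟨A, hA⟩ := exists_lintegral_weightedMeasure_bounds (lam := lam) (C := C) hε hβ hν
  set W : ℝ≥0 := (∫⁻ t in Set.Ici 0, rayWeight ε lam C t).toNNReal with hW
  have hW' : (W : ℝ≥0∞) = ∫⁻ t in Set.Ici 0, rayWeight ε lam C t :=
    ENNReal.coe_toNNReal (lintegral_rayWeight_ne_top hε hC)
  refine ⟨A * (W * Real.toNNReal (C ^ (-lam)) + 1), fun s => ?_⟩
  have hg := measurable_primitiveGradient ε s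
  set g := primitiveGradient ε s with hgdef
  set M : ℝ≥0∞ := ∫⁻ ξ, (∫⁻ t in Set.Ici 0, g (ray ξ t) * rayWeight ε lam C t) ∂ν with hM
  have hMle : M ≤ ∑' n : ℕ, ENNReal.ofReal ((n + C) ^ lam) *
      ∫⁻ ξ, (if n = 0 then 0 else ENNReal.ofReal |s (ξ.vertex n)|) ∂ν := by
    have hmeas : ∀ n : ℕ, Measurable fun ξ : TreeBoundary K => ENNReal.ofReal ((n + C) ^ lam) *
        (if n = 0 then 0 else ENNReal.ofReal |s (ξ.vertex n)|) := fun n =>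
      TreeBoundary.measurable_comp_vertex n fun x =>
        ENNReal.ofReal ((n + C) ^ lam) * (if n = 0 then 0 else ENNReal.ofReal |s x|)
    simp_rw [← lintegral_const_mul' _ _ ENNReal.ofReal_ne_top]
    rw [← lintegral_tsum fun n => (hmeas n).aemeasurable]
    refine lintegral_mono fun ξ => ?_
    simp only
    rw [lintegral_Ici_eq_tsum]
    refine ENNReal.tsum_le_tsum fun n => ?_
    by_cases hn : n = 0
    · simp [hn, edgeHeights_zero]
    rw [if_neg hn]
    calc ∫⁻ t in edgeHeights n, g (ray ξ t) * rayWeight ε lam C t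
        ≤ ∫⁻ t in edgeHeights n,
            ENNReal.ofReal ((n + C) ^ lam) * ENNReal.ofReal |s (ξ.vertex n)| := by
          refine setLIntegral_mono' (measurableSet_edgeHeights n) fun t ht => ?_
          have htn : t ≤ n := by
            rw [← ht.2]
            exact Nat.le_ceil t
          rw [rayWeight, ENNReal.ofReal_mul (Real.exp_pos _).le, ← mul_assoc, hgdef,
            primitiveGradient_ray_mul ε s ξ ht.1, ht.2, mul_comm]
          gcongr
          have := ht.1
          positivity
      _ ≤ _ := by
          rw [setLIntegral_const]
          exact mul_le_of_le_one_right' (volume_edgeHeights_le n)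
  have hgrad : ∫⁻ z, g z ∂(weightedMeasure K β lam C) ≤ A * M := (hA g hg).2
  have hL1 : ∫⁻ z, ENNReal.ofReal |primitive s z| ∂(weightedMeasure K β lam C) ≤
      A * (W * (Real.toNNReal (C ^ (-lam)) * M)) := by
    have hum : Measurable fun z : RegularTree K => ENNReal.ofReal |primitive s z| :=
      (measurable_primitive s).norm.ennreal_ofReal
    refine (hA _ hum).2.trans ?_
    gcongr
    rw [hM, ← lintegral_const_mul' _ _ ENNReal.coe_ne_top,
      ← lintegral_const_mul' _ _ ENNReal.coe_ne_top]
    refine lintegral_mono fun ξ => ?_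
    calc ∫⁻ t in Set.Ici 0, ENNReal.ofReal |primitive s (ray ξ t)| * rayWeight ε lam C t
        ≤ ∫⁻ t in Set.Ici 0, (Real.toNNReal (C ^ (-lam)) *
            ∫⁻ t in Set.Ici 0, g (ray ξ t) * rayWeight ε lam C t) * rayWeight ε lam C t := by
          refine setLIntegral_mono' measurableSet_Ici fun t ht => ?_
          gcongr
          have h1 := ofReal_abs_primitive_sub_le ε s ξ le_rfl ht
          rw [primitive_ray_zero, sub_zero] at h1
          refine h1.trans ((lintegral_mono_set fun τ hτ => hτ.1.le).trans
            (setLIntegral_ray_exp_le hlam hC g ξ))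
      _ = _ := by
          rw [lintegral_const_mul _ (measurable_rayWeight ε lam C), ← hW', mul_comm]
  calc newtonNorm ε (weightedMeasure K β lam C) (primitive s)
      ≤ A * (W * (Real.toNNReal (C ^ (-lam)) * M)) + A * M := by
        refine add_le_add hL1 (le_trans (iInf₂_le g (isUpperGradient_primitive ε s)) hgrad)
    _ = ((A * (W * Real.toNNReal (C ^ (-lam)) + 1) : ℝ≥0) : ℝ≥0∞) * M := by
        push_cast
        ring
    _ ≤ _ := by gcongr

end RegularTree

/-! ### Convergence of dyadic averages -/

section Averages

variable {K : ℕ} {ν : Measure (TreeBoundary K)}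

/-- The filtration of the boundary generated by the vertices of the rays. -/
def vertexFiltration (K : ℕ) :
    Filtration ℕ (inferInstance : MeasurableSpace (TreeBoundary K)) where
  seq n := MeasurableSpace.comap (fun ξ : TreeBoundary K => ξ.vertex n) ⊤
  mono' n m hnm := by
    rintro _ ⟨B, -, rfl⟩
    refine ⟨{x | x.take n ∈ B}, trivial, ?_⟩
    ext ξ
    simp only [Set.mem_preimage, Set.mem_ofPred_eq, ξ.take_vertex hnm]
  le' n := (TreeBoundary.measurable_vertex n).comap_le

theorem iSup_vertexFiltration (K : ℕ) :
    ⨆ n, vertexFiltration K n = (inferInstance : MeasurableSpace (TreeBoundary K)) := by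
  refine le_antisymm (iSup_le fun n => (vertexFiltration K).le n) ?_
  refine iSup_le fun i => ?_
  refine le_trans ?_ (le_iSup (fun n => (vertexFiltration K) n) (i + 1))
  rintro _ ⟨B, -, rfl⟩
  refine ⟨{x | ∃ b ∈ B, x[i]? = some b}, trivial, ?_⟩
  ext ξ
  simp [TreeBoundary.vertex_getElem?]

theorem condExp_vertexFiltration [IsFiniteMeasure ν]
    (hν0 : ∀ x : List (Fin K), ν (dyadicSet x) ≠ 0) {f : TreeBoundary K → ℝ}
    (hf : Integrable f ν) (n : ℕ) (ξ : TreeBoundary K) :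
    ν[f | vertexFiltration K n] ξ = dyadicAverage ν f (ξ.vertex n) := by
  set m := vertexFiltration K n with hm
  set h := ν[f | m] with hh
  have hmeas : Measurable[m] h := stronglyMeasurable_condExp.measurable
  -- a function of the vertex of level `n` is constant on the dyadic sets of level `n`
  have hconst : ∀ ζ ∈ dyadicSet (ξ.vertex n), h ζ = h ξ := by
    intro ζ hζ
    rw [TreeBoundary.mem_dyadicSet_vertex] at hζ
    obtain ⟨B, -, hB⟩ := hmeas (MeasurableSet.singleton (h ξ))
    have h1 : ξ ∈ h ⁻¹' {h ξ} := rfl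
    rw [← hB, Set.mem_preimage, ← hζ] at h1
    have h2 : ζ ∈ h ⁻¹' {h ξ} := hB ▸ h1
    exact h2
  have hS : MeasurableSet[m] (dyadicSet (ξ.vertex n)) := by
    refine ⟨{ξ.vertex n}, trivial, ?_⟩
    ext ζ
    rw [TreeBoundary.mem_dyadicSet_vertex]
    rfl
  have hint := setIntegral_condExp ((vertexFiltration K).le n) hf hS
  rw [← hm, ← hh, setIntegral_congr_fun (TreeBoundary.measurableSet_dyadicSet _) hconst,
    setIntegral_const] at hint
  have h0 : ν.real (dyadicSet (ξ.vertex n)) ≠ 0 :=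
    (ENNReal.toReal_pos (hν0 _) (measure_ne_top _ _)).ne'
  rw [dyadicAverage, setAverage_eq, ← hint, smul_smul, inv_mul_cancel₀ h0, one_smul]

/-- Lévy's upward theorem for the dyadic averages of an integrable function. -/
theorem ae_tendsto_dyadicAverage [IsFiniteMeasure ν]
    (hν0 : ∀ x : List (Fin K), ν (dyadicSet x) ≠ 0) {f : TreeBoundary K → ℝ}
    (hf : Integrable f ν) :
    ∀ᵐ ξ ∂ν, Tendsto (fun n => dyadicAverage ν f (ξ.vertex n)) atTop (𝓝 (f ξ)) := by
  have h1 := tendsto_ae_condExp (μ := ν) (ℱ := vertexFiltration K) f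
  rw [iSup_vertexFiltration] at h1
  filter_upwards [h1, condExp_of_aestronglyMeasurable' le_rfl hf.aestronglyMeasurable hf]
    with ξ h2 h3
  rw [h3] at h2
  exact h2.congr fun n => condExp_vertexFiltration hν0 hf n ξ

theorem lintegral_abs_dyadicAverage_le [IsFiniteMeasure ν]
    (hν0 : ∀ x : List (Fin K), ν (dyadicSet x) ≠ 0) {f : TreeBoundary K → ℝ}
    (hf : Integrable f ν) (n : ℕ) :
    ∫⁻ ξ, ENNReal.ofReal |dyadicAverage ν f (ξ.vertex n)| ∂ν ≤ eLpNorm f 1 ν := by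
  rw [eLpNorm_one_eq_lintegral_enorm]
  simp only [Real.enorm_eq_ofReal_abs]
  rw [← lintegral_dyadic_laverage hν0 (fun ξ => ENNReal.ofReal |f ξ|) n]
  refine lintegral_mono fun ξ => ?_
  have h := ofReal_abs_setAverage_sub_le (hν0 (ξ.vertex n)) (measure_ne_top _ _)
    hf.integrableOn 0
  simp only [sub_zero] at h
  exact h

theorem dyadicAverage_add {f g : TreeBoundary K → ℝ} (hf : Integrable f ν) (hg : Integrable g ν) :
    dyadicAverage ν (f + g) = dyadicAverage ν f + dyadicAverage ν g := by
  funext x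
  simp only [dyadicAverage, setAverage_eq, Pi.add_apply]
  rw [integral_add hf.integrableOn hg.integrableOn, smul_add]

theorem dyadicAverage_smul (c : ℝ) (f : TreeBoundary K → ℝ) :
    dyadicAverage ν (c • f) = c • dyadicAverage ν f := by
  funext x
  simp only [dyadicAverage, setAverage_eq, Pi.smul_apply, integral_smul]
  rw [smul_comm]

theorem dyadicAverage_congr {f g : TreeBoundary K → ℝ} (h : f =ᵐ[ν] g) :
    dyadicAverage ν f = dyadicAverage ν g :=
  funext fun _ => average_congr (ae_restrict_of_ae h)

end Averages

/-! ### The extension operator -/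

/-- The number of indices `i` with `α i ≤ m`, for a strictly increasing sequence `α`. -/
noncomputable def levelIndex (α : ℕ → ℕ) (m : ℕ) : ℕ := sInf {i | m < α i}

theorem lt_levelIndex_iff {α : ℕ → ℕ} (hα : StrictMono α) {i m : ℕ} :
    i < levelIndex α m ↔ α i ≤ m := by
  have hne : {i | m < α i}.Nonempty := ⟨m + 1, m.lt_succ_self.trans_le hα.le_apply⟩
  constructor
  · intro h
    have h1 : i ∉ {i | m < α i} := Nat.notMem_of_lt_sInf h
    exact not_lt.1 h1
  · intro h
    by_contra hlt
    have h1 : m < α (levelIndex α m) := Nat.sInf_mem hne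
    have h2 := hα.monotone (not_lt.1 hlt)
    omega

theorem levelIndex_apply {α : ℕ → ℕ} (hα : StrictMono α) (n : ℕ) :
    levelIndex α (α n) = n + 1 :=
  eq_of_forall_lt_iff fun i => by
    rw [lt_levelIndex_iff hα, hα.le_iff_le, Nat.lt_succ_iff]

theorem levelIndex_of_eq_succ {α : ℕ → ℕ} (hα : StrictMono α) {n m : ℕ} (h : α n = m + 1) :
    levelIndex α m = n :=
  eq_of_forall_lt_iff fun i => by
    rw [lt_levelIndex_iff hα, ← Nat.lt_succ_iff, Nat.succ_eq_add_one, ← h, hα.lt_iff_lt]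

theorem levelIndex_succ_of_notMem {α : ℕ → ℕ} (hα : StrictMono α) {m : ℕ}
    (h : m + 1 ∉ Set.range α) : levelIndex α (m + 1) = levelIndex α m :=
  eq_of_forall_lt_iff fun i => by
    rw [lt_levelIndex_iff hα, lt_levelIndex_iff hα]
    have : α i ≠ m + 1 := fun hi => h ⟨i, hi⟩
    omega

section Extension

variable {K : ℕ}

/-- The value of the extension of `f` at a vertex `x`, in terms of the averages `a = (f_I)_I`: the
average over `I_y`, where `y` is the last vertex on the geodesic from the root to `x` whose level
belongs to the sequence `α`; zero if there is no such vertex. -/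
noncomputable def vertexValue (α : ℕ → ℕ) (a : List (Fin K) → ℝ) (x : List (Fin K)) : ℝ :=
  if levelIndex α x.length = 0 then 0 else a (x.take (α (levelIndex α x.length - 1)))

/-- The increment of `vertexValue` along the edge with lower end point `x`. -/
noncomputable def vertexIncrement (α : ℕ → ℕ) (a : List (Fin K) → ℝ) (x : List (Fin K)) : ℝ :=
  vertexValue α a x - vertexValue α a x.dropLast

theorem vertexIncrement_add (α : ℕ → ℕ) (a b : List (Fin K) → ℝ) :
    vertexIncrement α (a + b) = vertexIncrement α a + vertexIncrement α b := by
  funext x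
  simp only [vertexIncrement, vertexValue, Pi.add_apply]
  split_ifs <;> ring

theorem vertexIncrement_smul (α : ℕ → ℕ) (c : ℝ) (a : List (Fin K) → ℝ) :
    vertexIncrement α (c • a) = c • vertexIncrement α a := by
  funext x
  simp only [vertexIncrement, vertexValue, Pi.smul_apply, smul_eq_mul]
  split_ifs <;> ring

theorem vertexValue_vertex {α : ℕ → ℕ} (hα : StrictMono α) (a : List (Fin K) → ℝ)
    (ξ : TreeBoundary K) (m : ℕ) :
    vertexValue α a (ξ.vertex m) =
      if levelIndex α m = 0 then 0 else a (ξ.vertex (α (levelIndex α m - 1))) := by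
  rw [vertexValue, ξ.length_vertex]
  split_ifs with h
  · rfl
  · rw [ξ.take_vertex ((lt_levelIndex_iff hα).1 (by omega))]

theorem vertexIncrement_vertex_succ (α : ℕ → ℕ) (a : List (Fin K) → ℝ) (ξ : TreeBoundary K)
    (m : ℕ) : vertexIncrement α a (ξ.vertex (m + 1)) =
      vertexValue α a (ξ.vertex (m + 1)) - vertexValue α a (ξ.vertex m) := by
  rw [vertexIncrement, List.dropLast_eq_take, ξ.length_vertex, Nat.add_sub_cancel,
    ξ.take_vertex m.le_succ]

theorem vertexIncrement_of_notMem {α : ℕ → ℕ} (hα : StrictMono α) (a : List (Fin K) → ℝ)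
    (ξ : TreeBoundary K) {m : ℕ} (h : m + 1 ∉ Set.range α) :
    vertexIncrement α a (ξ.vertex (m + 1)) = 0 := by
  rw [vertexIncrement_vertex_succ, vertexValue_vertex hα, vertexValue_vertex hα,
    levelIndex_succ_of_notMem hα h, sub_self]

theorem vertexIncrement_zero {α : ℕ → ℕ} (hα : StrictMono α) (h0 : 0 < α 0)
    (a : List (Fin K) → ℝ) (ξ : TreeBoundary K) :
    vertexIncrement α a (ξ.vertex (α 0)) = a (ξ.vertex (α 0)) := by
  obtain ⟨m, hm⟩ := Nat.exists_eq_succ_of_ne_zero h0.ne'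
  have h1 := vertexIncrement_vertex_succ α a ξ m
  rw [vertexValue_vertex hα, vertexValue_vertex hα, levelIndex_of_eq_succ hα hm,
    show m + 1 = α 0 from hm.symm, levelIndex_apply hα] at h1
  simpa using h1

theorem vertexIncrement_succ {α : ℕ → ℕ} (hα : StrictMono α) (a : List (Fin K) → ℝ)
    (ξ : TreeBoundary K) (n : ℕ) :
    vertexIncrement α a (ξ.vertex (α (n + 1))) =
      a (ξ.vertex (α (n + 1))) - a (ξ.vertex (α n)) := by
  obtain ⟨m, hm⟩ := Nat.exists_eq_succ_of_ne_zero (n := α (n + 1))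
    ((Nat.zero_le _).trans_lt (hα n.lt_succ_self)).ne'
  have h1 := vertexIncrement_vertex_succ α a ξ m
  rw [vertexValue_vertex hα, vertexValue_vertex hα, levelIndex_of_eq_succ hα hm,
    show m + 1 = α (n + 1) from hm.symm, levelIndex_apply hα] at h1
  simpa using h1

theorem primitive_vertexIncrement_ray {α : ℕ → ℕ} (hα : StrictMono α) (h0 : 0 < α 0)
    (a : List (Fin K) → ℝ) (ξ : TreeBoundary K) (n : ℕ) :
    RegularTree.primitive (vertexIncrement α a) (RegularTree.ray ξ (α n)) =
      a (ξ.vertex (α n)) := by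
  rw [RegularTree.primitive_ray_natCast]
  simp only [vertexIncrement_vertex_succ]
  have hz : levelIndex α 0 = 0 := by
    by_contra h
    have := (lt_levelIndex_iff hα).1 (Nat.pos_of_ne_zero h)
    omega
  rw [Finset.sum_range_sub (fun m => vertexValue α a (ξ.vertex m)), vertexValue_vertex hα,
    vertexValue_vertex hα, levelIndex_apply hα, hz]
  simp

variable {ν : Measure (TreeBoundary K)}

/-- Along each ray the increments sit on the edges ending at the levels `α(n)`, where they are the
differences of averages that make up the energy; the first one is controlled by the `L¹` norm. -/
theorem exists_tsum_vertexIncrement_le [IsFiniteMeasure ν]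
    (hν0 : ∀ x : List (Fin K), ν (dyadicSet x) ≠ 0) {lam C : ℝ} (hlam : 0 < lam) (hC : 0 < C)
    {α : ℕ → ℕ} (hα : IsLacunary α) :
    ∃ A : ℝ≥0, ∀ f : TreeBoundary K → ℝ, Integrable f ν →
      ∑' n : ℕ, ENNReal.ofReal ((n + C) ^ lam) *
        ∫⁻ ξ, (if n = 0 then 0 else
          ENNReal.ofReal |vertexIncrement α (dyadicAverage ν f) (ξ.vertex n)|) ∂ν ≤
      A * besovNorm lam α ν f := by
  have hmono := hα.strictMono
  have hpos := hα.pos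
  refine ⟨Real.toNNReal ((α 0 + C) ^ lam) + Real.toNNReal ((1 + C) ^ lam), fun f hf => ?_⟩
  rw [← hmono.injective.tsum_eq]
  swap
  · intro n hn
    by_contra hr
    refine hn ?_
    cases n with
    | zero => simp
    | succ m => simp [vertexIncrement_of_notMem hmono _ _ hr]
  rw [tsum_eq_zero_add' ENNReal.summable, besovNorm, ENNReal.coe_add, add_mul]
  simp only [(hpos _).ne', if_false]
  refine add_le_add ?_ ?_
  · refine mul_le_mul' le_rfl (le_trans ?_ le_self_add)
    simp only [vertexIncrement_zero hmono (hpos 0)]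
    exact lintegral_abs_dyadicAverage_le hν0 hf _
  · refine le_trans ?_ (mul_le_mul' le_rfl le_add_self)
    rw [besovEnergy_eq_tsum_lintegral hmono.monotone, ← ENNReal.tsum_mul_left]
    refine ENNReal.tsum_le_tsum fun n => ?_
    simp only [vertexIncrement_succ hmono]
    rw [← mul_assoc]
    refine mul_le_mul' ?_ le_rfl
    change _ ≤ ENNReal.ofReal _ * _
    rw [← ENNReal.ofReal_mul (by positivity), ← Real.mul_rpow (by positivity) (by positivity)]
    refine ENNReal.ofReal_le_ofReal (Real.rpow_le_rpow (by positivity) ?_ hlam.le)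
    have : (1 : ℝ) ≤ α (n + 1) := by exact_mod_cast hpos (n + 1)
    nlinarith

end Extension

theorem theorem1p3 (K : ℕ) (hK : 2 ≤ K) (β ε lam C : ℝ)
    (hβ : Real.log (K : ℝ) < β) (hε : 0 < ε) (hlam : 0 < lam)
    (hp : (β - Real.log (K : ℝ)) / ε = 1)
    (hC : max (2 * |lam| / (β - Real.log (K : ℝ))) (2 * Real.log 4 / ε) ≤ C)
    (ν : Measure (TreeBoundary K)) (hν : IsAhlforsRegular ε (Real.log (K : ℝ) / ε) ν)
    (α : ℕ → ℕ) (hα : IsLacunary α) :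
    ∃ (T : RegularTree.newtonSpace ε (RegularTree.weightedMeasure K β lam C) →ₗ[ℝ]
          besovSpace lam α ν)
      (E : besovSpace lam α ν →ₗ[ℝ]
          RegularTree.newtonSpace ε (RegularTree.weightedMeasure K β lam C)),
      -- `T` is the trace operator given by limits along geodesic rays
      (∀ f : RegularTree.newtonSpace ε (RegularTree.weightedMeasure K β lam C),
        ∀ᵐ ξ ∂ν, Tendsto (fun t : ℝ => (f : RegularTree K → ℝ) (RegularTree.ray ξ t)) atTop
          (𝓝 ((T f : Lp ℝ 1 ν) ξ))) ∧
      -- `T` is bounded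
      (∃ A : ℝ≥0, ∀ f : RegularTree.newtonSpace ε (RegularTree.weightedMeasure K β lam C),
        besovNorm lam α ν ((T f : Lp ℝ 1 ν) : TreeBoundary K → ℝ) ≤
          A * RegularTree.newtonNorm ε (RegularTree.weightedMeasure K β lam C) f) ∧
      -- `E` is bounded
      (∃ A : ℝ≥0, ∀ u : besovSpace lam α ν,
        RegularTree.newtonNorm ε (RegularTree.weightedMeasure K β lam C) (E u) ≤
          A * besovNorm lam α ν ((u : Lp ℝ 1 ν) : TreeBoundary K → ℝ)) ∧
      -- `E` is a right inverse of `T`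
      T ∘ₗ E = LinearMap.id := by
  have : NeZero K := ⟨by omega⟩
  have hβ' : β - Real.log K = ε := (div_eq_one_iff_eq hε.ne').1 hp
  have hC0 : 0 < C := by
    refine lt_of_lt_of_le ?_ ((le_max_right _ _).trans hC)
    have : 0 < Real.log 4 := Real.log_pos (by norm_num)
    positivity
  have hfin := hν.isFiniteMeasure hε
  have hν0 := hν.measure_dyadicSet_ne_zero hε
  have hmono := hα.strictMono
  have hα0 := hα.pos 0
  set μ := RegularTree.weightedMeasure K β lam C with hμ
  -- the trace operator; limits along rays determine it almost everywhere, hence it is linear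
  choose T hT using fun u : RegularTree.newtonSpace ε μ =>
    RegularTree.exists_trace hε hβ' hlam hC0 hα hν u
  have hTuniq : ∀ (u : RegularTree.newtonSpace ε μ) (φ : besovSpace lam α ν),
      (∀ᵐ ξ ∂ν, Tendsto (fun t : ℝ => (u : RegularTree K → ℝ) (RegularTree.ray ξ t)) atTop
        (𝓝 ((φ : Lp ℝ 1 ν) ξ))) → T u = φ := by
    intro u φ h
    refine Subtype.ext (Lp.ext ?_)
    filter_upwards [hT u, h] with ξ h1 h2 using tendsto_nhds_unique h1 h2
  let Tl : RegularTree.newtonSpace ε μ →ₗ[ℝ] besovSpace lam α ν :=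
    { toFun := T
      map_add' := fun u v => hTuniq _ _ <| by
        filter_upwards [hT u, hT v, Lp.coeFn_add (T u : Lp ℝ 1 ν) (T v : Lp ℝ 1 ν)]
          with ξ h1 h2 h3
        change Tendsto _ _ (𝓝 (((T u : Lp ℝ 1 ν) + (T v : Lp ℝ 1 ν) : Lp ℝ 1 ν) ξ))
        rw [h3]
        exact h1.add h2
      map_smul' := fun c u => hTuniq _ _ <| by
        filter_upwards [hT u, Lp.coeFn_smul c (T u : Lp ℝ 1 ν)] with ξ h1 h2
        change Tendsto _ _ (𝓝 ((c • (T u : Lp ℝ 1 ν) : Lp ℝ 1 ν) ξ))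
        rw [h2]
        exact h1.const_smul c }
  -- the extension operator
  obtain ⟨A₁, hA₁⟩ := RegularTree.exists_newtonNorm_primitive_le hε hβ' hlam hC0 hν
  obtain ⟨A₂, hA₂⟩ := exists_tsum_vertexIncrement_le hν0 hlam hC0 hα
  let e : (TreeBoundary K → ℝ) → RegularTree K → ℝ := fun f =>
    RegularTree.primitive (vertexIncrement α (dyadicAverage ν f))
  have hb : ∀ f : besovSpace lam α ν, RegularTree.newtonNorm ε μ (e (f : Lp ℝ 1 ν)) ≤
      (A₁ * A₂ : ℝ≥0) * besovNorm lam α ν ((f : Lp ℝ 1 ν) : TreeBoundary K → ℝ) := by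
    intro f
    refine (hA₁ _).trans ?_
    push_cast
    rw [mul_assoc]
    gcongr
    exact hA₂ _ (L1.integrable_coeFn _)
  have hmem : ∀ f : besovSpace lam α ν, e (f : Lp ℝ 1 ν) ∈ RegularTree.newtonSpace ε μ := by
    intro f
    refine ⟨(RegularTree.measurable_primitive _).aestronglyMeasurable, (hb f).trans_lt ?_⟩
    exact ENNReal.mul_lt_top ENNReal.coe_lt_top
      (ENNReal.add_lt_top.2 ⟨Lp.eLpNorm_lt_top _, f.2⟩)
  let El : besovSpace lam α ν →ₗ[ℝ] RegularTree.newtonSpace ε μ :=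
    { toFun := fun f => ⟨e (f : Lp ℝ 1 ν), hmem f⟩
      map_add' := fun f g => Subtype.ext <| by
        simp only [e, Submodule.coe_add]
        rw [dyadicAverage_congr (Lp.coeFn_add (f : Lp ℝ 1 ν) (g : Lp ℝ 1 ν)),
          dyadicAverage_add (L1.integrable_coeFn _) (L1.integrable_coeFn _),
          vertexIncrement_add, RegularTree.primitive_add]
      map_smul' := fun c f => Subtype.ext <| by
        simp only [e, Submodule.coe_smul, RingHom.id_apply]
        rw [dyadicAverage_congr (Lp.coeFn_smul c (f : Lp ℝ 1 ν)), dyadicAverage_smul,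
          vertexIncrement_smul, RegularTree.primitive_smul] }
  obtain ⟨A, hA⟩ := RegularTree.exists_besovNorm_trace_le hε hβ' hlam hC0 hα hν
  refine ⟨Tl, El, hT, ⟨A, fun u => hA _ _ u.2.1 u.2.2 (Lp.aestronglyMeasurable _) (hT u)⟩,
    ⟨A₁ * A₂, hb⟩, LinearMap.ext fun f => Subtype.ext (Lp.ext ?_)⟩
  -- the limit along a ray can be computed on the levels `α n`, where `E f` is an average of `f`
  filter_upwards [hT (El f), ae_tendsto_dyadicAverage hν0 (L1.integrable_coeFn (f : Lp ℝ 1 ν))]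
    with ξ h1 h2
  have hαtop := hmono.tendsto_atTop
  refine tendsto_nhds_unique ((h1.comp (tendsto_natCast_atTop_atTop.comp hαtop)).congr fun n => ?_)
    (h2.comp hαtop)
  exact primitive_vertexIncrement_ray hmono hα0 _ ξ n
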